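/- For a field $\mathbb F$ and integers $k\ge 2$, $n\ge 0$, a $k$-tensor over $\mathbb F$ is a multilinear map $T\colon(\mathbb F^n)^k\to\mathbb F$. A nonzero $k$-tensor is reducible if there is a partition $[k]=A\sqcup B$ with $A,B$ nonempty and multilinear forms $P\colon(\mathbb F^n)^A\to\mathbb F$, $Q\colon(\mathbb F^n)^B\to\mathbb F$ such that $T(x_1,\dots,x_k)=P(x_i: i\in A)\,Q(x_j: j\in B)$ for all $x_1,\dots,x_k\in\mathbb F^n$. The partition rank $\mathrm{PR}(T)$ is the least $r\ge 0$ such that $T$ is a sum of $r$ reducible $k$-tensors. If $\mathbb F$ is finite, the analytic rank of $T$ is $\mathrm{AR}(T)=-\log_{|\mathbb F|}\mathrm{bias}(T)$, where $\mathrm{bias}(T)=\Pr_x[T(x)=0]-\Pr_x[T(x)=1]$ for uniformly random $x\in(\mathbb F^n)^k$ (here $1$ may be replaced by any nonzero $y\in\mathbb F$). Theorem. For every integer $k\ge 2$ there is a constant $C_k>0$, depending only on $k$, such that for every $\varepsilon\in(0,1]$, every finite field $\mathbb F$, every $n\ge 0$ and every $k$-tensor $T\colon(\mathbb F^n)^k\to\mathbb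 F$ with $$|\mathbb F|\;\ge\;\frac{C_k\,(\mathrm{AR}(T)+1)^{k-2}}{\varepsilon},$$ we have $$\mathrm{PR}(T)\;\le\;(2^{k-1}-1+\varepsilon)\,\mathrm{AR}(T).$$ -/

import Mathlib

namespace TensorRank

/-- A `k`-tensor over `F`: a multilinear map `(F^n)^k → F`. -/
abbrev Tensor (F : Type*) [Field F] (k n : ℕ) :=
  MultilinearMap F (fun _ : Fin k => Fin n → F) F

/-- A nonzero `k`-tensor is reducible if, for some partition of its `k` arguments into two
nonempty blocks, it is the product of a multilinear form in the arguments of the first block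
and a multilinear form in the arguments of the second block. -/
def IsReducible {F : Type*} [Field F] {k n : ℕ} (T : Tensor F k n) : Prop :=
  T ≠ 0 ∧ ∃ S : Finset (Fin k), S.Nonempty ∧ Sᶜ.Nonempty ∧
    ∃ (P : MultilinearMap F (fun _ : {i : Fin k // i ∈ S} => Fin n → F) F)
      (Q : MultilinearMap F (fun _ : {i : Fin k // i ∉ S} => Fin n → F) F),
      ∀ x : Fin k → Fin n → F, T x = P (fun i => x i) * Q (fun i => x i)

/-- `T` is a sum of `r` reducible tensors. -/
def IsSumOfReducible {F : Type*} [Field F] {k n : ℕ} (T : Tensor F k n) (r : ℕ) : Prop :=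
  ∃ R : Fin r → Tensor F k n, (∀ i, IsReducible (R i)) ∧ T = ∑ i, R i

/-- Partition rank: the least number of reducible tensors that sum to `T`
(such a number exists when `2 ≤ k`, see `exists_isSumOfReducible`). -/
noncomputable def partitionRank {F : Type*} [Field F] {k n : ℕ} (T : Tensor F k n) : ℕ :=
  sInf {r : ℕ | IsSumOfReducible T r}

/-- The bias `Pr[T(x) = 0] - Pr[T(x) = 1]`, for uniformly random `x ∈ (F^n)^k`. As `T` is
multilinear and `2 ≤ k`, all nonzero values are equally likely, so `1` may be replaced by any
nonzero `y`. -/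
noncomputable def bias {F : Type*} [Field F] {k n : ℕ} (T : Tensor F k n) : ℝ :=
  (Nat.card {x : Fin k → Fin n → F // T x = 0} : ℝ) / Nat.card (Fin k → Fin n → F) -
    (Nat.card {x : Fin k → Fin n → F // T x = 1} : ℝ) / Nat.card (Fin k → Fin n → F)

/-- Analytic rank of a tensor over a finite field: `-log_{|F|} bias(T)`. -/
noncomputable def analyticRank {F : Type*} [Field F] {k n : ℕ} (T : Tensor F k n) : ℝ :=
  -Real.logb (Nat.card F) (bias T)

theorem isSumOfReducible_zero {F : Type*} [Field F] {k n : ℕ} :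
    IsSumOfReducible (0 : Tensor F k n) 0 :=
  ⟨fun i => i.elim0, fun i => i.elim0, by simp⟩

theorem IsSumOfReducible.add {F : Type*} [Field F] {k n : ℕ} {T T' : Tensor F k n} {r r' : ℕ}
    (h : IsSumOfReducible T r) (h' : IsSumOfReducible T' r') :
    IsSumOfReducible (T + T') (r + r') := by
  obtain ⟨R, hR, rfl⟩ := h
  obtain ⟨R', hR', rfl⟩ := h'
  refine ⟨Fin.append R R', fun i => ?_, by simp [Fin.sum_univ_add]⟩
  induction i using Fin.addCases with
  | left i => simpa using hR i
  | right i => simpa using hR' i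

theorem exists_isSumOfReducible {F : Type*} [Field F] {k n : ℕ} (hk : 2 ≤ k)
    (T : Tensor F k n) : ∃ r, IsSumOfReducible T r := by
  classical
  let a : Fin k := ⟨0, by omega⟩
  let b : Fin k := ⟨1, by omega⟩
  have hab : b ≠ a := by simp [a, b, Fin.ext_iff]
  -- the form `x ↦ x_a(j)` in the single argument `a`, and `T` with `e_j` put in place `a`
  let P : Fin n → MultilinearMap F (fun _ : {i : Fin k // i ∈ ({a} : Finset (Fin k))} =>
      Fin n → F) F := fun j =>
    { toFun := fun x => x ⟨a, by simp⟩ j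
      map_update_add' := by
        rintro _ m ⟨i, hi⟩ x y
        obtain rfl : i = a := by simpa using hi
        simp
      map_update_smul' := by
        rintro _ m ⟨i, hi⟩ c x
        obtain rfl : i = a := by simpa using hi
        simp }
  let ext : Fin n → ({i : Fin k // i ∉ ({a} : Finset (Fin k))} → Fin n → F) →
      Fin k → Fin n → F := fun j x i =>
    if h : i ∉ ({a} : Finset (Fin k)) then x ⟨i, h⟩ else Pi.single j 1
  have hext : ∀ (_ : DecidableEq {i : Fin k // i ∉ ({a} : Finset (Fin k))}) j x
      (i : {i : Fin k // i ∉ ({a} : Finset (Fin k))}) v,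
      ext j (Function.update x i v) = Function.update (ext j x) i v := by
    intro _ j x i v
    funext l
    by_cases hl : l = (i : Fin k)
    · subst hl
      simp only [ext, Function.update_self, dif_pos i.2]
    · rw [Function.update_of_ne hl]
      by_cases h : l ∉ ({a} : Finset (Fin k))
      · have : (⟨l, h⟩ : {i : Fin k // i ∉ ({a} : Finset (Fin k))}) ≠ i :=
          fun e => hl (congrArg Subtype.val e)
        simp only [ext, dif_pos h, Function.update_of_ne this]
      · simp only [ext, dif_neg h]
  let Q : Fin n → MultilinearMap F (fun _ : {i : Fin k // i ∉ ({a} : Finset (Fin k))} =>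
      Fin n → F) F := fun j =>
    { toFun := fun x => T (ext j x)
      map_update_add' := by
        intro _ m i x y
        simp only [hext, T.map_update_add]
      map_update_smul' := by
        intro _ m i c x
        simp only [hext, T.map_update_smul] }
  let R : Fin n → Tensor F k n := fun j =>
    { toFun := fun x => x a j * T (Function.update x a (Pi.single j 1))
      map_update_add' := by
        intro inst m i x y
        obtain rfl : inst = fun p q => instDecidableEqFin k p q := Subsingleton.elim _ _
        by_cases h : i = a
        · subst h
          simp [add_mul]
        · rw [Function.update_comm h, Function.update_comm h, Function.update_comm h]
          simp [Function.update_of_ne (Ne.symm h), mul_add]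
      map_update_smul' := by
        intro inst m i c x
        obtain rfl : inst = fun p q => instDecidableEqFin k p q := Subsingleton.elim _ _
        by_cases h : i = a
        · subst h
          simp [mul_assoc]
        · rw [Function.update_comm h, Function.update_comm h]
          simp [Function.update_of_ne (Ne.symm h)]
          ring }
  have hT : T = ∑ j, R j := by
    refine MultilinearMap.ext fun x => ?_
    have h1 : x = Function.update x a (∑ j, x a j • Pi.single j (1 : F)) := by
      rw [← pi_eq_sum_univ' (x a)]
      simp
    conv_lhs => rw [h1]
    rw [T.map_update_sum]
    simp [R]
  have hR : ∀ j, ∃ r, IsSumOfReducible (R j) r := by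
    intro j
    by_cases h0 : R j = 0
    · exact ⟨0, h0 ▸ isSumOfReducible_zero⟩
    · refine ⟨1, fun _ => R j, fun _ => ⟨h0, {a}, by simp, ⟨b, by simpa using hab⟩,
        P j, Q j, fun x => ?_⟩, by simp⟩
      have : Function.update x a (Pi.single j 1) = ext j (fun i => x i) := by
        funext i
        by_cases hi : i = a
        · subst hi
          simp [ext]
        · simp [ext, hi]
      simp [R, P, Q, this]
  choose r hr using hR
  have key : ∀ s : Finset (Fin n), ∃ r, IsSumOfReducible (∑ j ∈ s, R j) r := by
    intro s
    induction s using Finset.induction_on with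
    | empty => exact ⟨0, by simpa using isSumOfReducible_zero⟩
    | insert j s hj ih =>
      obtain ⟨r', h'⟩ := ih
      exact ⟨r j + r', by rw [Finset.sum_insert hj]; exact (hr j).add h'⟩
  rw [hT]
  exact key Finset.univ

end TensorRank

/-! Write `m = k - 1`, `q = |F|`, and let `Z` be the set of points where `T` vanishes identically in
the last argument. A linear form is either zero or equidistributed, so `bias T` is the density of
`Z`. With all other coordinates fixed, the `j`-th coordinates of points of `Z` form the kernel of a
matrix, the slice in arguments `j` and last. Hence resampling coordinate `j` uniformly in that
kernel preserves the uniform measure on `Z`. Rank-nullity makes the mean of `q ^ rank` over `Z`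
equal to `q ^ AR(T)`, and convexity bounds the mean rank by `AR(T)`. Sweep through the `m`
coordinates, weighting the slice rank met at coordinate `i` by `2 ^ i`. Some starting point `x₀`
then has expected weighted sum at most `(2 ^ m - 1) AR(T)` (`exists_sum_sweepAverage_le`).

The sweep has an algebraic model. A random kernel vector is replaced by `K X`, where `K` is
`kernelMatrix` and `X` a vector of fresh variables; let `ρ_i` be the rank of the `i`-th slice at the
resulting generic point. After all `m` steps the generic point lies in the zero locus, so `T`
specialised there is zero. Going backwards, releasing coordinate `i` costs `ρ_i` reducible terms and
a differentiation in the variables of that coordinate, and the product rule doubles the number of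
terms already present. So `PR(T) ≤ ∑ 2 ^ i ρ_i`, provided the chosen maximal minors are all nonzero
at some `F`-point (`partitionRank_le_sum_minorRank`).

The two sides meet through Schwartz–Zippel. Where the minors do not vanish, the parametrised sweep
has the law of the random one, so the expected rank at step `i` is at least `ρ_i (1 - D / q)`
(`mul_le_sweepAverage_rank`). The degree bound `D` is of order `(AR(T) + 1) ^ (k - 2)`, which gives
the hypothesis on `|F|`. -/

open Matrix Function

namespace TensorRank

/-! ### Maximal minors and polynomial projections onto kernels. -/

section Minors

variable {R S : Type*} [CommRing R] [CommRing S] {n ρ : ℕ}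

/-- For an invertible minor of maximal size, this is (up to the minor) a projection onto the
kernel of `M`. -/
noncomputable def kernelMatrix (M : Matrix (Fin n) (Fin n) R) (I J : Fin ρ → Fin n) :
    Matrix (Fin n) (Fin n) R :=
  (M.submatrix I J).det • 1 -
    (1 : Matrix (Fin n) (Fin n) R).submatrix id J *
      ((M.submatrix I J).adjugate * M.submatrix I id)

theorem map_kernelMatrix (φ : R →+* S) (M : Matrix (Fin n) (Fin n) R) (I J : Fin ρ → Fin n) :
    (kernelMatrix M I J).map φ = kernelMatrix (M.map φ) I J := by
  have h1 : (M.map φ).submatrix I J = φ.mapMatrix (M.submatrix I J) := rfl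
  ext a b
  rw [kernelMatrix, kernelMatrix, h1, ← RingHom.map_adjugate, ← RingHom.map_det]
  simp [Matrix.mul_apply, Matrix.one_apply, apply_ite φ]

theorem kernelMatrix_mulVec (M : Matrix (Fin n) (Fin n) R) (I J : Fin ρ → Fin n)
    (v : Fin n → R) :
    kernelMatrix M I J *ᵥ v = (M.submatrix I J).det • v -
      ∑ e, ((M.submatrix I J).adjugate *ᵥ fun l => (M *ᵥ v) (I l)) e • Pi.single (J e) 1 := by
  have h : (M.submatrix I id) *ᵥ v = fun l => (M *ᵥ v) (I l) := rfl
  rw [kernelMatrix, Matrix.sub_mulVec, Matrix.smul_mulVec, Matrix.one_mulVec,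
    ← Matrix.mulVec_mulVec, ← Matrix.mulVec_mulVec, h]
  congr 1
  ext a
  simp [Matrix.mulVec, dotProduct, Matrix.one_apply, Pi.single_apply]

theorem kernelMatrix_mulVec_of_mulVec_eq_zero (M : Matrix (Fin n) (Fin n) R)
    (I J : Fin ρ → Fin n) {v : Fin n → R} (hv : M *ᵥ v = 0) :
    kernelMatrix M I J *ᵥ v = (M.submatrix I J).det • v := by
  rw [kernelMatrix_mulVec, hv]
  have : (fun l => (0 : Fin n → R) (I l)) = (0 : Fin ρ → R) := rfl
  rw [this, Matrix.mulVec_zero]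
  simp

/-- Each entry of the product is a bordered minor of size `ρ + 1`, by the Schur complement formula.
-/
theorem mul_kernelMatrix_of_field {K : Type*} [Field K] (M : Matrix (Fin n) (Fin n) K)
    (I J : Fin ρ → Fin n) (h : (M.submatrix I J).det ≠ 0)
    (h0 : ∀ I J : Fin (ρ + 1) → Fin n, (M.submatrix I J).det = 0) :
    M * kernelMatrix M I J = 0 := by
  ext a b
  have hM : M * kernelMatrix M I J = (M.submatrix I J).det • M -
      M.submatrix id J * ((M.submatrix I J).adjugate * M.submatrix I id) := by
    rw [kernelMatrix, Matrix.mul_sub, Matrix.mul_smul, Matrix.mul_one, ← Matrix.mul_assoc]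
    congr 2
    ext a e
    simp [Matrix.mul_apply, Matrix.one_apply]
  have : Invertible (M.submatrix I J) := Matrix.invertibleOfIsUnitDet _ (isUnit_iff_ne_zero.2 h)
  -- Border the chosen minor by row `a` and column `b`.
  have key := h0 (Sum.elim I (fun _ : Fin 1 => a) ∘ finSumFinEquiv.symm)
    (Sum.elim J (fun _ : Fin 1 => b) ∘ finSumFinEquiv.symm)
  have hb : M.submatrix (Sum.elim I (fun _ : Fin 1 => a)) (Sum.elim J (fun _ : Fin 1 => b)) =
      Matrix.fromBlocks (M.submatrix I J) (M.submatrix I fun _ => b)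
        (M.submatrix (fun _ => a) J) (M.submatrix (fun _ => a) fun _ => b) := by
    ext (i | i) (j | j) <;> rfl
  rw [← Matrix.submatrix_submatrix, Matrix.det_submatrix_equiv_self, hb,
    Matrix.det_fromBlocks₁₁, mul_eq_zero, or_iff_right h, Matrix.det_fin_one,
    Matrix.invOf_eq_nonsing_inv, Matrix.inv_def, Ring.inverse_eq_inv'] at key
  rw [hM, Matrix.zero_apply, Matrix.sub_apply, Matrix.smul_apply, smul_eq_mul]
  have e2 : (M.submatrix id J * ((M.submatrix I J).adjugate * M.submatrix I id)) a b =
      (M.submatrix (fun _ : Fin 1 => a) J * (M.submatrix I J).adjugate *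
        M.submatrix I fun _ : Fin 1 => b) 0 0 := by
    rw [← Matrix.mul_assoc]
    rfl
  rw [e2]
  rw [Matrix.sub_apply, Matrix.mul_smul, Matrix.smul_mul, Matrix.smul_apply, smul_eq_mul] at key
  have := congrArg ((M.submatrix I J).det * ·) key
  simp only [mul_sub, mul_zero, mul_inv_cancel_left₀ h] at this
  exact this

theorem mul_kernelMatrix [IsDomain R] (M : Matrix (Fin n) (Fin n) R)
    (I J : Fin ρ → Fin n) (h : (M.submatrix I J).det ≠ 0)
    (h0 : ∀ I J : Fin (ρ + 1) → Fin n, (M.submatrix I J).det = 0) :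
    M * kernelMatrix M I J = 0 := by
  set φ := algebraMap R (FractionRing R)
  have hφ : Function.Injective φ := IsFractionRing.injective R (FractionRing R)
  have hdet : ∀ {s : ℕ} (I J : Fin s → Fin n),
      ((M.map φ).submatrix I J).det = φ (M.submatrix I J).det := fun I J => by
    rw [RingHom.map_det]; rfl
  have := mul_kernelMatrix_of_field (M.map φ) I J
    (by rw [hdet]; exact fun e => h (hφ (by simpa using e)))
    (fun I J => by rw [hdet, h0, map_zero])
  rw [← map_kernelMatrix, ← Matrix.map_mul] at this
  exact Matrix.map_injective hφ (by simpa using this)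

theorem exists_minors_vanish (M : Matrix (Fin n) (Fin n) R) :
    ∃ ρ, ∀ I J : Fin (ρ + 1) → Fin n, (M.submatrix I J).det = 0 := by
  refine ⟨n, fun I J => ?_⟩
  obtain ⟨i, j, hij, h⟩ := Fintype.exists_ne_map_eq_of_card_lt I (by simp)
  exact Matrix.det_zero_of_row_eq hij (by ext; simp [h])

open Classical in
/-- The least size from which on all minors of `M` vanish. -/
noncomputable def minorRank (M : Matrix (Fin n) (Fin n) R) : ℕ :=
  Nat.find (exists_minors_vanish M)

theorem det_submatrix_eq_zero_of_minorRank (M : Matrix (Fin n) (Fin n) R)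
    (I J : Fin (minorRank M + 1) → Fin n) : (M.submatrix I J).det = 0 := by
  classical
  exact Nat.find_spec (exists_minors_vanish M) I J

theorem exists_minor_ne_zero [Nontrivial R] (M : Matrix (Fin n) (Fin n) R) {s : ℕ}
    (hs : s ≤ minorRank M) : ∃ I J : Fin s → Fin n, (M.submatrix I J).det ≠ 0 := by
  classical
  cases s with
  | zero => exact ⟨Fin.elim0, Fin.elim0, by simp⟩
  | succ s =>
    have := Nat.find_min (exists_minors_vanish M) (m := s) hs
    push Not at this
    exact this

/-- The rows of a nonvanishing minor of maximal size. -/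
noncomputable def minorRows [Nontrivial R] (M : Matrix (Fin n) (Fin n) R) :
    Fin (minorRank M) → Fin n :=
  (exists_minor_ne_zero M le_rfl).choose

/-- The columns of a nonvanishing minor of maximal size. -/
noncomputable def minorCols [Nontrivial R] (M : Matrix (Fin n) (Fin n) R) :
    Fin (minorRank M) → Fin n :=
  (exists_minor_ne_zero M le_rfl).choose_spec.choose

/-- A nonvanishing minor of maximal size. -/
noncomputable def maxMinor [Nontrivial R] (M : Matrix (Fin n) (Fin n) R) : R :=
  (M.submatrix (minorRows M) (minorCols M)).det

theorem maxMinor_ne_zero [Nontrivial R] (M : Matrix (Fin n) (Fin n) R) : maxMinor M ≠ 0 :=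
  (exists_minor_ne_zero M le_rfl).choose_spec.choose_spec

theorem le_rank_of_minor_ne_zero {K : Type*} [Field K] (M : Matrix (Fin n) (Fin n) K)
    (I J : Fin ρ → Fin n) (h : (M.submatrix I J).det ≠ 0) : ρ ≤ M.rank := by
  have h1 := Matrix.rank_of_isUnit (M.submatrix I J)
    ((Matrix.isUnit_iff_isUnit_det _).2 (isUnit_iff_ne_zero.2 h))
  rw [Fintype.card_fin] at h1
  exact h1 ▸ Matrix.rank_submatrix_le M I J

end Minors

/-! ### Extension of scalars and bilinear slices of a tensor. -/

section BaseChange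

variable {F : Type*} [Field F] {k m n : ℕ}

/-- The extension of scalars of a tensor. -/
noncomputable def baseChange (T : Tensor F k n) (A : Type*) [CommRing A] [Algebra F A] :
    MultilinearMap A (fun _ : Fin k => Fin n → A) A :=
  ∑ σ : Fin k → Fin n, algebraMap F A (T fun i => Pi.single (σ i) 1) •
    (MultilinearMap.mkPiAlgebra A (Fin k) A).compLinearMap fun i => LinearMap.proj (σ i)

theorem baseChange_apply (T : Tensor F k n) (A : Type*) [CommRing A] [Algebra F A]
    (x : Fin k → Fin n → A) : baseChange T A x =
      ∑ σ : Fin k → Fin n, algebraMap F A (T fun i => Pi.single (σ i) 1) * ∏ i, x i (σ i) := by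
  simp [baseChange]

theorem baseChange_self (T : Tensor F k n) : baseChange T F = T := by
  refine MultilinearMap.ext fun x => ?_
  have hx : x = fun i => ∑ a, x i a • Pi.single a (1 : F) := by
    funext i
    rw [← pi_eq_sum_univ' (x i)]
  rw [baseChange_apply]
  conv_rhs => rw [hx, T.map_sum]
  refine Finset.sum_congr rfl fun σ _ => ?_
  rw [T.map_smul_univ, smul_eq_mul, mul_comm]
  rfl

theorem map_baseChange (T : Tensor F k n) {A B : Type*} [CommRing A] [Algebra F A] [CommRing B]
    [Algebra F B] (φ : A →ₐ[F] B) (x : Fin k → Fin n → A) :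
    φ (baseChange T A x) = baseChange T B fun i a => φ (x i a) := by
  simp [baseChange_apply]

/-- The matrix of the bilinear form obtained from a tensor by fixing all arguments but the
`j`-th one (columns) and the last one (rows). -/
noncomputable def slice (T : Tensor F (m + 1) n) {A : Type*} [CommRing A] [Algebra F A]
    (x : Fin (m + 1) → Fin n → A) (j : Fin (m + 1)) : Matrix (Fin n) (Fin n) A :=
  Matrix.of fun a b =>
    baseChange T A (update (update x j (Pi.single b 1)) (Fin.last m) (Pi.single a 1))

theorem map_slice (T : Tensor F (m + 1) n) {A B : Type*} [CommRing A] [Algebra F A] [CommRing B]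
    [Algebra F B] (φ : A →ₐ[F] B) (x : Fin (m + 1) → Fin n → A) (j : Fin (m + 1)) :
    (slice T x j).map φ = slice T (fun i a => φ (x i a)) j := by
  ext a b
  rw [Matrix.map_apply, slice, slice, Matrix.of_apply, Matrix.of_apply, map_baseChange]
  congr 1
  ext i c
  by_cases h : i = Fin.last m
  · subst h
    simp [Pi.single_apply, apply_ite φ]
  · by_cases h' : i = j
    · subst h'
      simp [h, Pi.single_apply, apply_ite φ]
    · simp [h, h']

theorem slice_mulVec (T : Tensor F (m + 1) n) {A : Type*} [CommRing A] [Algebra F A]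
    (x : Fin (m + 1) → Fin n → A) {j : Fin (m + 1)} (hj : j ≠ Fin.last m) (v : Fin n → A)
    (a : Fin n) : (slice T x j *ᵥ v) a =
      baseChange T A (update (update x j v) (Fin.last m) (Pi.single a 1)) := by
  have hv : v = ∑ b, v b • Pi.single b (1 : A) := by rw [← pi_eq_sum_univ' v]
  conv_rhs => rw [update_comm hj, hv, MultilinearMap.map_update_sum]
  simp only [MultilinearMap.map_update_smul, Matrix.mulVec, dotProduct, slice, Matrix.of_apply]
  refine Finset.sum_congr rfl fun b _ => ?_
  rw [update_comm hj, smul_eq_mul, mul_comm]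

theorem dotProduct_slice_mulVec (T : Tensor F (m + 1) n) {A : Type*} [CommRing A] [Algebra F A]
    (x : Fin (m + 1) → Fin n → A) {j : Fin (m + 1)} (hj : j ≠ Fin.last m) (v w : Fin n → A) :
    w ⬝ᵥ (slice T x j *ᵥ v) = baseChange T A (update (update x j v) (Fin.last m) w) := by
  have hw : w = ∑ b, w b • Pi.single b (1 : A) := by rw [← pi_eq_sum_univ' w]
  conv_rhs => rw [hw, MultilinearMap.map_update_sum]
  simp only [MultilinearMap.map_update_smul, dotProduct, smul_eq_mul, slice_mulVec T x hj]

theorem slice_update_self (T : Tensor F (m + 1) n) {A : Type*} [CommRing A] [Algebra F A]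
    (x : Fin (m + 1) → Fin n → A) (j : Fin (m + 1)) (v : Fin n → A) :
    slice T (update x j v) j = slice T x j := by
  simp [slice]

end BaseChange

/-! ### The generic sweep over a polynomial ring. -/

section GenericPoint

variable {F : Type*} [Field F] {m n : ℕ}

/-- One step of the sweep: the `i`-th coordinate is replaced by a generic element of the kernel. -/
noncomputable def sweepStep (T : Tensor F (m + 1) n) (i : Fin m)
    (p : Fin (m + 1) → Fin n → MvPolynomial (Fin m × Fin n) F) :
    Fin (m + 1) → Fin n → MvPolynomial (Fin m × Fin n) F :=
  update p i.castSucc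
    (kernelMatrix (slice T p i.castSucc) (minorRows (slice T p i.castSucc))
      (minorCols (slice T p i.castSucc)) *ᵥ
      fun a => MvPolynomial.X (i, a))

/-- The generic point obtained from `x₀` after resampling the coordinates before `j`. -/
noncomputable def genericPoint (T : Tensor F (m + 1) n) (x₀ : Fin (m + 1) → Fin n → F) :
    Fin (m + 1) → Fin (m + 1) → Fin n → MvPolynomial (Fin m × Fin n) F :=
  Fin.induction (fun i a => MvPolynomial.C (x₀ i a)) fun i p => sweepStep T i p

/-- The slice of the tensor at the generic point. -/
noncomputable def genericSlice (T : Tensor F (m + 1) n) (x₀ : Fin (m + 1) → Fin n → F)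
    (i : Fin m) : Matrix (Fin n) (Fin n) (MvPolynomial (Fin m × Fin n) F) :=
  slice T (genericPoint T x₀ i.castSucc) i.castSucc

theorem genericPoint_zero (T : Tensor F (m + 1) n) (x₀ : Fin (m + 1) → Fin n → F) :
    genericPoint T x₀ 0 = fun i a => MvPolynomial.C (x₀ i a) := rfl

theorem genericPoint_succ (T : Tensor F (m + 1) n) (x₀ : Fin (m + 1) → Fin n → F) (i : Fin m) :
    genericPoint T x₀ i.succ = update (genericPoint T x₀ i.castSucc) i.castSucc
      (kernelMatrix (genericSlice T x₀ i) (minorRows (genericSlice T x₀ i))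
        (minorCols (genericSlice T x₀ i)) *ᵥ
        fun a => MvPolynomial.X (i, a)) := rfl

theorem genericSlice_mul_kernelMatrix (T : Tensor F (m + 1) n) (x₀ : Fin (m + 1) → Fin n → F)
    (i : Fin m) : genericSlice T x₀ i *
      kernelMatrix (genericSlice T x₀ i) (minorRows (genericSlice T x₀ i))
        (minorCols (genericSlice T x₀ i)) = 0 :=
  mul_kernelMatrix _ _ _ (maxMinor_ne_zero _) (det_submatrix_eq_zero_of_minorRank _)

variable {A : Type*} [CommRing A] [Algebra F A]

theorem map_kernelMatrix_genericSlice (T : Tensor F (m + 1) n) (x₀ : Fin (m + 1) → Fin n → F)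
    (i : Fin m) (φ : MvPolynomial (Fin m × Fin n) F →ₐ[F] A) :
    (kernelMatrix (genericSlice T x₀ i) (minorRows (genericSlice T x₀ i))
        (minorCols (genericSlice T x₀ i))).map φ =
      kernelMatrix (slice T (fun l a => φ (genericPoint T x₀ i.castSucc l a)) i.castSucc)
        (minorRows (genericSlice T x₀ i)) (minorCols (genericSlice T x₀ i)) := by
  rw [← map_slice]
  exact map_kernelMatrix φ.toRingHom _ _ _

theorem map_maxMinor_genericSlice (T : Tensor F (m + 1) n) (x₀ : Fin (m + 1) → Fin n → F)
    (i : Fin m) (φ : MvPolynomial (Fin m × Fin n) F →ₐ[F] A) :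
    ((slice T (fun l a => φ (genericPoint T x₀ i.castSucc l a)) i.castSucc).submatrix
      (minorRows (genericSlice T x₀ i)) (minorCols (genericSlice T x₀ i))).det =
        φ (maxMinor (genericSlice T x₀ i)) := by
  rw [← map_slice, maxMinor, AlgHom.map_det]
  rfl

theorem map_genericPoint_succ (T : Tensor F (m + 1) n) (x₀ : Fin (m + 1) → Fin n → F) (i : Fin m)
    (φ : MvPolynomial (Fin m × Fin n) F →ₐ[F] A) :
    (fun l a => φ (genericPoint T x₀ i.succ l a)) =
      update (fun l a => φ (genericPoint T x₀ i.castSucc l a)) i.castSucc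
        (kernelMatrix (slice T (fun l a => φ (genericPoint T x₀ i.castSucc l a)) i.castSucc)
          (minorRows (genericSlice T x₀ i)) (minorCols (genericSlice T x₀ i)) *ᵥ
            fun a => φ (MvPolynomial.X (i, a))) := by
  rw [genericPoint_succ, ← map_kernelMatrix_genericSlice]
  funext l
  by_cases h : l = i.castSucc
  · subst h
    funext a
    simp [Matrix.mulVec, dotProduct]
  · simp [update_of_ne h]

/-- Stage `j` of the sweep involves only the variables of coordinates before `j`. In particular the
kernel matrix used at step `i` is constant in the variables of coordinate `i`, so the new coordinate
is linear in them. -/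
theorem map_genericPoint_congr (T : Tensor F (m + 1) n) (x₀ : Fin (m + 1) → Fin n → F)
    {φ ψ : MvPolynomial (Fin m × Fin n) F →ₐ[F] A} (j : Fin (m + 1))
    (h : ∀ i : Fin m, i.castSucc < j → ∀ a,
      φ (MvPolynomial.X (i, a)) = ψ (MvPolynomial.X (i, a))) :
    (fun l a => φ (genericPoint T x₀ j l a)) = fun l a => ψ (genericPoint T x₀ j l a) := by
  induction j using Fin.induction with
  | zero =>
    funext l a
    rw [genericPoint_zero, ← MvPolynomial.algebraMap_eq, φ.commutes, ψ.commutes]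
  | succ i ih =>
    rw [map_genericPoint_succ, map_genericPoint_succ,
      ih fun l hl => h l (hl.trans i.castSucc_lt_succ)]
    simp only [h i i.castSucc_lt_succ]

end GenericPoint

/-! ### Partition rank over a commutative ring, and its behaviour under differentiation. -/

section FormOn

variable {ι A : Type*} [DecidableEq ι] [CommRing A] {n : ℕ}

/-- `g` depends only on the arguments in `B`, and is linear in each of them. -/
structure IsFormOn (B : Finset ι) (g : (ι → Fin n → A) → A) : Prop where
  congr : ∀ x y, (∀ i ∈ B, x i = y i) → g x = g y
  map_add : ∀ x, ∀ i ∈ B, ∀ u v, g (update x i (u + v)) = g (update x i u) + g (update x i v)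
  map_smul : ∀ x, ∀ i ∈ B, ∀ (c : A) u, g (update x i (c • u)) = c * g (update x i u)

/-- `f` is a sum of `r` products of two forms in complementary nonempty subsets of the
arguments in `U`. -/
def HasPartitionRank (U : Finset ι) (f : (ι → Fin n → A) → A) (r : ℕ) : Prop :=
  ∃ (κ : Type) (_ : Fintype κ) (B : κ → Finset ι) (P Q : κ → (ι → Fin n → A) → A),
    Fintype.card κ = r ∧
    (∀ l, (B l).Nonempty ∧ (U \ B l).Nonempty ∧ B l ⊆ U ∧
      IsFormOn (B l) (P l) ∧ IsFormOn (U \ B l) (Q l)) ∧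
    ∀ z, f z = ∑ l, P l z * Q l z

theorem hasPartitionRank_zero (U : Finset ι) :
    HasPartitionRank U (fun _ : ι → Fin n → A => 0) 0 :=
  ⟨Empty, inferInstance, fun _ => ∅, fun _ _ => 0, fun _ _ => 0, rfl, fun l => l.elim, by simp⟩

theorem HasPartitionRank.add {U : Finset ι} {f g : (ι → Fin n → A) → A} {r s : ℕ}
    (hf : HasPartitionRank U f r) (hg : HasPartitionRank U g s) :
    HasPartitionRank U (fun z => f z + g z) (r + s) := by
  obtain ⟨κ, _, B, P, Q, rfl, h, hf⟩ := hf
  obtain ⟨κ', _, B', P', Q', rfl, h', hg⟩ := hg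
  refine ⟨κ ⊕ κ', inferInstance, Sum.elim B B', Sum.elim P P', Sum.elim Q Q', by simp, ?_, ?_⟩
  · rintro (l | l)
    exacts [h l, h' l]
  · intro z
    simp [hf, hg]

theorem IsFormOn.const_mul {B : Finset ι} {g : (ι → Fin n → A) → A} (hg : IsFormOn B g) (c : A) :
    IsFormOn B fun z => c * g z where
  congr x y h := by rw [hg.congr x y h]
  map_add x i hi u v := by rw [hg.map_add x i hi, mul_add]
  map_smul x i hi d u := by rw [hg.map_smul x i hi, mul_left_comm]

theorem HasPartitionRank.const_mul {U : Finset ι} {f : (ι → Fin n → A) → A} {r : ℕ}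
    (hf : HasPartitionRank U f r) (c : A) : HasPartitionRank U (fun z => c * f z) r := by
  obtain ⟨κ, _, B, P, Q, rfl, h, hf⟩ := hf
  refine ⟨κ, inferInstance, B, fun l z => c * P l z, Q, rfl, fun l => ?_, fun z => ?_⟩
  · exact ⟨(h l).1, (h l).2.1, (h l).2.2.1, (h l).2.2.2.1.const_mul c, (h l).2.2.2.2⟩
  · simp [hf, Finset.mul_sum, mul_assoc]

theorem inl_update (z : ι → Fin n → A) (i : ι) (u : Fin n → A) :
    (fun l b => (TrivSqZeroExt.inl (update z i u l b) : TrivSqZeroExt A (Fin n → A))) =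
      update (fun l b => TrivSqZeroExt.inl (z l b)) i fun b => TrivSqZeroExt.inl (u b) := by
  funext l
  by_cases h : l = i
  · subst h
    simp
  · simp [h]

theorem inl_update_add (z : ι → Fin n → A) (i : ι) (u v : Fin n → A) :
    (fun l b => (TrivSqZeroExt.inl (update z i (u + v) l b) : TrivSqZeroExt A (Fin n → A))) =
      update (fun l b => TrivSqZeroExt.inl (z l b)) i
        ((fun b => TrivSqZeroExt.inl (u b)) + fun b => TrivSqZeroExt.inl (v b)) := by
  rw [inl_update]
  congr 1
  funext b
  simp

theorem inl_update_smul (z : ι → Fin n → A) (i : ι) (c : A) (u : Fin n → A) :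
    (fun l b => (TrivSqZeroExt.inl (update z i (c • u) l b) : TrivSqZeroExt A (Fin n → A))) =
      update (fun l b => TrivSqZeroExt.inl (z l b)) i
        ((TrivSqZeroExt.inl c : TrivSqZeroExt A (Fin n → A)) •
          fun b => TrivSqZeroExt.inl (u b)) := by
  rw [inl_update]
  congr 1
  funext b
  simp

theorem IsFormOn.fst_inl {B : Finset ι}
    {g : (ι → Fin n → TrivSqZeroExt A (Fin n → A)) → TrivSqZeroExt A (Fin n → A)}
    (hg : IsFormOn B g) :
    IsFormOn B fun z : ι → Fin n → A => (g fun i b => TrivSqZeroExt.inl (z i b)).fst where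
  congr x y h := by rw [hg.congr _ (fun i b => .inl (y i b)) fun i hi => by rw [h i hi]]
  map_add x i hi u v := by
    simp only [inl_update_add, inl_update, hg.map_add _ i hi, TrivSqZeroExt.fst_add]
  map_smul x i hi c u := by
    simp only [inl_update_smul, inl_update, hg.map_smul _ i hi, TrivSqZeroExt.fst_mul,
      TrivSqZeroExt.fst_inl]

/-- The infinitesimal part of a form, evaluated at non-infinitesimal arguments, is a vector of forms
in the same arguments. Contracting it with `z c` adds `c` as a linear argument. -/
theorem IsFormOn.snd_inl {B : Finset ι} {c : ι} (hc : c ∉ B)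
    {g : (ι → Fin n → TrivSqZeroExt A (Fin n → A)) → TrivSqZeroExt A (Fin n → A)}
    (hg : IsFormOn B g) :
    IsFormOn (insert c B) fun z : ι → Fin n → A =>
      ∑ a, z c a * (g fun i b => TrivSqZeroExt.inl (z i b)).snd a where
  congr x y h := by
    rw [hg.congr _ (fun i b => .inl (y i b)) fun i hi => by rw [h i (Finset.mem_insert_of_mem hi)],
      h c (Finset.mem_insert_self _ _)]
  map_add x i hi u v := by
    rcases Finset.mem_insert.1 hi with rfl | hi
    · have h : ∀ w, g (fun l b => .inl (update x i w l b)) = g fun l b => .inl (x l b) :=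
        fun w => hg.congr _ _ fun l hl => by
          rw [update_of_ne (by rintro rfl; exact hc hl)]
      simp only [h, update_self, Pi.add_apply, add_mul, Finset.sum_add_distrib]
    · have hci : c ≠ i := fun e => hc (e ▸ hi)
      simp only [inl_update_add, inl_update, hg.map_add _ i hi, TrivSqZeroExt.snd_add, update_of_ne hci,
        Pi.add_apply, mul_add, Finset.sum_add_distrib]
  map_smul x i hi d u := by
    rcases Finset.mem_insert.1 hi with rfl | hi
    · have h : ∀ w, g (fun l b => .inl (update x i w l b)) = g fun l b => .inl (x l b) :=
        fun w => hg.congr _ _ fun l hl => by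
          rw [update_of_ne (by rintro rfl; exact hc hl)]
      simp only [h, update_self, Pi.smul_apply, smul_eq_mul, mul_assoc, Finset.mul_sum]
    · have hci : c ≠ i := fun e => hc (e ▸ hi)
      simp only [inl_update_smul, inl_update, hg.map_smul _ i hi, update_of_ne hci, TrivSqZeroExt.snd_mul,
        TrivSqZeroExt.fst_inl, TrivSqZeroExt.snd_inl, smul_zero, add_zero, Pi.smul_apply,
        smul_eq_mul, Finset.mul_sum]
      exact Finset.sum_congr rfl fun a _ => mul_left_comm _ _ _

/-- Differentiating a decomposition doubles the number of terms. -/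
theorem HasPartitionRank.derivative {U : Finset ι} {c : ι} (hc : c ∉ U)
    {g : (ι → Fin n → TrivSqZeroExt A (Fin n → A)) → TrivSqZeroExt A (Fin n → A)} {r : ℕ}
    (hg : HasPartitionRank U g r) :
    HasPartitionRank (insert c U) (fun z : ι → Fin n → A =>
      ∑ a, z c a * (g fun i b => TrivSqZeroExt.inl (z i b)).snd a) (2 * r) := by
  obtain ⟨κ, _, B, P, Q, rfl, h, hg⟩ := hg
  -- Product rule: the first copy differentiates `Q`, so `c` joins its block; the second
  -- differentiates `P`.
  refine ⟨κ ⊕ κ, inferInstance, Sum.elim B fun l => insert c (B l),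
    Sum.elim (fun l z => (P l fun i b => .inl (z i b)).fst)
      (fun l z => ∑ a, z c a * (P l fun i b => .inl (z i b)).snd a),
    Sum.elim (fun l z => ∑ a, z c a * (Q l fun i b => .inl (z i b)).snd a)
      (fun l z => (Q l fun i b => .inl (z i b)).fst), by simp; ring, ?_, fun z => ?_⟩
  · rintro (l | l) <;> obtain ⟨h1, h2, h3, h4, h5⟩ := h l
    · have e : insert c U \ B l = insert c (U \ B l) :=
        Finset.insert_sdiff_of_notMem _ fun hl => hc (h3 hl)
      refine ⟨h1, ?_, h3.trans (Finset.subset_insert _ _), h4.fst_inl, ?_⟩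
      · simp [e]
      · rw [Sum.elim_inl, e]
        exact h5.snd_inl fun hl => hc (Finset.sdiff_subset hl)
    · have e : insert c U \ insert c (B l) = U \ B l := by
        ext i
        by_cases hi : i = c
        · subst hi
          simp [hc]
        · simp [hi]
      refine ⟨by simp, ?_, Finset.insert_subset_insert _ h3, h4.snd_inl fun hl => hc (h3 hl), ?_⟩
      · simpa [e] using h2
      · rw [Sum.elim_inr, e]
        exact h5.fst_inl
  · simp only [hg, TrivSqZeroExt.snd_sum, TrivSqZeroExt.snd_mul, Finset.sum_apply, Pi.add_apply,
      Fintype.sum_sum_type, Sum.elim_inl, Sum.elim_inr, ← Finset.sum_add_distrib, Finset.mul_sum,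
      Finset.sum_mul]
    rw [Finset.sum_comm]
    refine Finset.sum_congr rfl fun l _ => Finset.sum_congr rfl fun a _ => ?_
    simp only [Pi.smul_apply, smul_eq_mul, MulOpposite.smul_eq_mul_unop, MulOpposite.unop_op]
    ring

end FormOn

/-! ### Comparison with the partition rank of tensors. -/

section PartitionRank

variable {F : Type*} [Field F] {k n : ℕ}

/-- A form in the arguments of `B` as a multilinear map on the subtype. -/
noncomputable def IsFormOn.toMultilinearMap {p : Fin k → Prop} {B : Finset (Fin k)}
    (hp : ∀ i, p i ↔ i ∈ B) {g : (Fin k → Fin n → F) → F} (hg : IsFormOn B g) :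
    MultilinearMap F (fun _ : {i : Fin k // p i} => Fin n → F) F :=
  haveI : DecidablePred p := Classical.decPred p
  have key : ∀ (x : {i : Fin k // p i} → Fin n → F) (i : {i : Fin k // p i}) (v : Fin n → F),
      (fun l => if h : p l then update x i v ⟨l, h⟩ else 0) =
        update (fun l => if h : p l then x ⟨l, h⟩ else 0) i.1 v := fun x i v => by
    funext l
    by_cases hl : l = i
    · subst hl
      simp [i.2]
    · rw [update_of_ne hl]
      by_cases h : p l
      · have : (⟨l, h⟩ : {i : Fin k // p i}) ≠ i := fun e => hl (congrArg Subtype.val e)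
        simp [h, this]
      · simp [h]
  MultilinearMap.mk' (fun x => g fun i => if h : p i then x ⟨i, h⟩ else 0)
    (fun x i u v => by
      simp only [key]
      exact hg.map_add _ i.1 ((hp _).1 i.2) u v)
    (fun x i c u => by
      simp only [key]
      exact hg.map_smul _ i.1 ((hp _).1 i.2) c u)

theorem IsFormOn.toMultilinearMap_apply {p : Fin k → Prop} {B : Finset (Fin k)}
    (hp : ∀ i, p i ↔ i ∈ B) {g : (Fin k → Fin n → F) → F} (hg : IsFormOn B g)
    (x : Fin k → Fin n → F) : hg.toMultilinearMap hp (fun i => x i) = g x := by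
  classical
  exact hg.congr _ _ fun i hi => by simp [(hp i).2 hi]

/-- A product of forms may be zero, and zero is not reducible; such terms are dropped, which can
only shorten the sum. -/
theorem HasPartitionRank.partitionRank_le {T : Tensor F k n} {r : ℕ}
    (h : HasPartitionRank Finset.univ (fun z => T z) r) : partitionRank T ≤ r := by
  classical
  obtain ⟨κ, _, B, P, Q, rfl, h, hT⟩ := h
  have hupd : ∀ (l : κ) (x : Fin k → Fin n → F) (i : Fin k),
      (i ∈ B l ∧ ∀ u, Q l (update x i u) = Q l x) ∨
      (i ∈ Finset.univ \ B l ∧ ∀ u, P l (update x i u) = P l x) := fun l x i => by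
    by_cases hi : i ∈ B l
    · refine .inl ⟨hi, fun u => (h l).2.2.2.2.congr _ _ fun a ha => ?_⟩
      rw [update_of_ne]
      rintro rfl
      simp [hi] at ha
    · refine .inr ⟨by simpa using hi, fun u => (h l).2.2.2.1.congr _ _ fun a ha => ?_⟩
      rw [update_of_ne]
      rintro rfl
      exact hi ha
  let R : κ → Tensor F k n := fun l => MultilinearMap.mk' (fun x => P l x * Q l x)
    (fun x i u v => by
      rcases hupd l x i with ⟨hi, e⟩ | ⟨hi, e⟩
      · rw [e, e, e, (h l).2.2.2.1.map_add x i hi, add_mul]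
      · rw [e, e, e, (h l).2.2.2.2.map_add x i hi, mul_add])
    (fun x i c u => by
      rcases hupd l x i with ⟨hi, e⟩ | ⟨hi, e⟩
      · rw [e, e, (h l).2.2.2.1.map_smul x i hi, smul_eq_mul, mul_assoc]
      · rw [e, e, (h l).2.2.2.2.map_smul x i hi, smul_eq_mul, mul_left_comm])
  have hR : ∀ l, ∃ s ≤ 1, IsSumOfReducible (R l) s := fun l => by
    by_cases h0 : R l = 0
    · exact ⟨0, by simp, h0 ▸ isSumOfReducible_zero⟩
    · refine ⟨1, le_rfl, fun _ => R l, fun _ => ⟨h0, B l, (h l).1, ?_,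
        (h l).2.2.2.1.toMultilinearMap fun i => Iff.rfl,
        (h l).2.2.2.2.toMultilinearMap fun i => by simp, fun x => ?_⟩, by simp⟩
      · simpa [Finset.compl_eq_univ_sdiff] using (h l).2.1
      · rw [IsFormOn.toMultilinearMap_apply, IsFormOn.toMultilinearMap_apply]
        rfl
  have hsum : ∀ s : Finset κ, ∃ t ≤ s.card, IsSumOfReducible (∑ l ∈ s, R l) t := fun s => by
    induction s using Finset.induction_on with
    | empty => exact ⟨0, by simp, by simpa using isSumOfReducible_zero⟩
    | insert l s hl ih =>
      obtain ⟨t, ht, h1⟩ := ih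
      obtain ⟨t', ht', h2⟩ := hR l
      refine ⟨t' + t, ?_, by rw [Finset.sum_insert hl]; exact h2.add h1⟩
      rw [Finset.card_insert_of_notMem hl]
      omega
  obtain ⟨t, ht, h1⟩ := hsum Finset.univ
  have e : T = ∑ l, R l := by
    refine MultilinearMap.ext fun x => ?_
    simpa [R] using hT x
  rw [← e] at h1
  exact (Nat.sInf_le h1).trans (by simpa using ht)

end PartitionRank

/-! ### Upper bound for the partition rank by generic slice ranks. -/

section Sweep

universe u
variable {F : Type u} [Field F] {m n : ℕ}

/-- The directions in which the parameters of the `i`-th coordinate are perturbed generically. -/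
noncomputable def perturb (i : Fin m) {A : Type u} [CommRing A] [Algebra F A]
    (φ : MvPolynomial (Fin m × Fin n) F →ₐ[F] A) :
    MvPolynomial (Fin m × Fin n) F →ₐ[F] TrivSqZeroExt A (Fin n → A) :=
  MvPolynomial.aeval fun p => .inl (φ (.X p)) + if p.1 = i then .inr (Pi.single p.2 1) else 0

theorem fst_perturb (i : Fin m) {A : Type u} [CommRing A] [Algebra F A]
    (φ : MvPolynomial (Fin m × Fin n) F →ₐ[F] A) (f : MvPolynomial (Fin m × Fin n) F) :
    (perturb i φ f).fst = φ f := by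
  have : (TrivSqZeroExt.fstHom F A (Fin n → A)).comp (perturb i φ) = φ := by
    refine MvPolynomial.algHom_ext fun p => ?_
    by_cases h : p.1 = i <;> simp [perturb, h]
  exact congrArg (fun ψ : MvPolynomial (Fin m × Fin n) F →ₐ[F] A => ψ f) this

theorem perturb_genericPoint (T : Tensor F (m + 1) n) (x₀ : Fin (m + 1) → Fin n → F) (i : Fin m)
    {A : Type u} [CommRing A] [Algebra F A] (φ : MvPolynomial (Fin m × Fin n) F →ₐ[F] A) :
    (fun l a => perturb i φ (genericPoint T x₀ i.castSucc l a)) =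
      fun l a => .inl (φ (genericPoint T x₀ i.castSucc l a)) := by
  refine map_genericPoint_congr T x₀ (ψ := (TrivSqZeroExt.inlAlgHom F A (Fin n → A)).comp φ)
    i.castSucc fun l hl a => ?_
  have : l ≠ i := by
    rintro rfl
    exact lt_irrefl _ hl
  simp [perturb, this]

/-- The tensor with the arguments before `j` specialised to `p`. -/
noncomputable def specialize (T : Tensor F (m + 1) n) {A : Type u} [CommRing A] [Algebra F A]
    (j : Fin (m + 1)) (p z : Fin (m + 1) → Fin n → A) : A :=
  baseChange T A fun l => if l < j then p l else z l

theorem specialize_update (T : Tensor F (m + 1) n) {A : Type u} [CommRing A] [Algebra F A]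
    (i : Fin m) (p z : Fin (m + 1) → Fin n → A) (v : Fin n → A) :
    specialize T i.castSucc p (update z i.castSucc v) =
      specialize T i.succ (update p i.castSucc v) z := by
  unfold specialize
  congr 1
  funext l
  by_cases h : l = i.castSucc
  · subst h
    simp
  · have : l < i.succ ↔ l < i.castSucc := by
      rw [Fin.ext_iff] at h
      simp only [Fin.lt_def, Fin.val_succ, Fin.val_castSucc] at h ⊢
      omega
    simp [h, this]

theorem specialize_update_sum (T : Tensor F (m + 1) n) {A : Type u} [CommRing A] [Algebra F A]
    {j i : Fin (m + 1)} (hji : j ≤ i) (p z : Fin (m + 1) → Fin n → A) {κ : Type*} (s : Finset κ)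
    (v : κ → Fin n → A) :
    specialize T j p (update z i (∑ a ∈ s, v a)) = ∑ a ∈ s, specialize T j p (update z i (v a)) := by
  have key : ∀ v : Fin n → A, (fun l => if l < j then p l else update z i v l) =
      update (fun l => if l < j then p l else z l) i v := fun v => by
    funext l
    by_cases h : l = i
    · subst h
      simp [hji.not_gt]
    · simp [h]
  simp only [specialize, key, MultilinearMap.map_update_sum]

theorem specialize_update_smul (T : Tensor F (m + 1) n) {A : Type u} [CommRing A] [Algebra F A]
    {j i : Fin (m + 1)} (hji : j ≤ i) (p z : Fin (m + 1) → Fin n → A) (c : A) (v : Fin n → A) :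
    specialize T j p (update z i (c • v)) = c * specialize T j p (update z i v) := by
  have key : ∀ v : Fin n → A, (fun l => if l < j then p l else update z i v l) =
      update (fun l => if l < j then p l else z l) i v := fun v => by
    funext l
    by_cases h : l = i
    · subst h
      simp [hji.not_gt]
    · simp [h]
  simp only [specialize, key, MultilinearMap.map_update_smul, smul_eq_mul]

theorem specialize_update_add (T : Tensor F (m + 1) n) {A : Type u} [CommRing A] [Algebra F A]
    {j i : Fin (m + 1)} (hji : j ≤ i) (p z : Fin (m + 1) → Fin n → A) (v w : Fin n → A) :
    specialize T j p (update z i (v + w)) =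
      specialize T j p (update z i v) + specialize T j p (update z i w) := by
  simpa using specialize_update_sum T hji p z Finset.univ ![v, w]

theorem map_specialize (T : Tensor F (m + 1) n) {A B : Type u} [CommRing A] [Algebra F A]
    [CommRing B] [Algebra F B] (φ : A →ₐ[F] B) (j : Fin (m + 1)) (p z : Fin (m + 1) → Fin n → A) :
    φ (specialize T j p z) =
      specialize T j (fun l a => φ (p l a)) fun l a => φ (z l a) := by
  rw [specialize, specialize, map_baseChange]
  congr 1
  funext l
  split_ifs <;> rfl

theorem isFormOn_specialize (T : Tensor F (m + 1) n) {A : Type u} [CommRing A] [Algebra F A]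
    (j : Fin (m + 1)) (p : Fin (m + 1) → Fin n → A) :
    IsFormOn (Finset.Ici j) (specialize T j p) where
  congr x y h := by
    unfold specialize
    congr 1
    funext l
    by_cases hl : l < j
    · simp [hl]
    · simp [hl, h l (by simpa using hl)]
  map_add x i hi u v := specialize_update_add T (by simpa using hi) p x u v
  map_smul x i hi c u := specialize_update_smul T (by simpa using hi) p x c u

/-- The derivative in the variable `X (i, a)`: coordinate `i` of the generic point is `K X_i` with
`K` and the earlier coordinates independent of `X_i`, so differentiating replaces that coordinate by
`K e_a`. -/
theorem snd_specialize_perturb (T : Tensor F (m + 1) n) (x₀ : Fin (m + 1) → Fin n → F)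
    (i : Fin m) {A : Type u} [CommRing A] [Algebra F A]
    (φ : MvPolynomial (Fin m × Fin n) F →ₐ[F] A) (z : Fin (m + 1) → Fin n → A) (a : Fin n) :
    (specialize T i.succ (fun l a => perturb i φ (genericPoint T x₀ i.succ l a))
      fun l b => .inl (z l b)).snd a =
    specialize T i.castSucc (fun l a => φ (genericPoint T x₀ i.castSucc l a))
      (update z i.castSucc
        (kernelMatrix (slice T (fun l a => φ (genericPoint T x₀ i.castSucc l a)) i.castSucc)
          (minorRows (genericSlice T x₀ i)) (minorCols (genericSlice T x₀ i)) *ᵥ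
            Pi.single a 1)) := by
  set p := fun l a => φ (genericPoint T x₀ i.castSucc l a) with hp
  set K := kernelMatrix (slice T p i.castSucc) (minorRows (genericSlice T x₀ i))
    (minorCols (genericSlice T x₀ i)) with hK
  have h1 := perturb_genericPoint T x₀ i φ
  have hK' : kernelMatrix (slice T (fun l a =>
      perturb i φ (genericPoint T x₀ i.castSucc l a)) i.castSucc)
      (minorRows (genericSlice T x₀ i)) (minorCols (genericSlice T x₀ i)) =
      K.map (TrivSqZeroExt.inlAlgHom F A (Fin n → A)) := by
    rw [h1, hK]
    refine Eq.trans ?_ (map_kernelMatrix (TrivSqZeroExt.inlAlgHom F A (Fin n → A)).toRingHom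
      _ _ _).symm
    congr 1
    exact (map_slice T (TrivSqZeroExt.inlAlgHom F A (Fin n → A)) p i.castSucc).symm
  rw [map_genericPoint_succ, hK', h1, ← specialize_update]
  have hy : ((K.map (TrivSqZeroExt.inlAlgHom F A (Fin n → A))) *ᵥ
      fun a => perturb i φ (MvPolynomial.X (i, a))) =
      ∑ a, perturb i φ (MvPolynomial.X (i, a)) •
        fun b => (TrivSqZeroExt.inl ((K *ᵥ Pi.single a 1) b) : TrivSqZeroExt A (Fin n → A)) := by
    funext b
    simp only [Matrix.mulVec_single_one, Matrix.col_apply]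
    simp [Matrix.mulVec, dotProduct, mul_comm]
  rw [hy, specialize_update_sum T le_rfl]
  simp only [specialize_update_smul T le_rfl, ← inl_update]
  have h2 : ∀ z : Fin (m + 1) → Fin n → A,
      specialize T i.castSucc (fun l a => (TrivSqZeroExt.inl (p l a) : TrivSqZeroExt A (Fin n → A)))
        (fun l a => .inl (z l a)) = .inl (specialize T i.castSucc p z) := fun z =>
    (map_specialize T (TrivSqZeroExt.inlAlgHom F A (Fin n → A)) i.castSucc p z).symm
  simp only [hp] at h2 ⊢
  simp only [h2]
  simp [perturb, Finset.sum_apply, Pi.single_apply, TrivSqZeroExt.snd_sum]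

/-- Backward induction with `r_j = ρ_j + 2 r_{j+1}`; multiplied by `2 ^ j`, this telescopes into the
stated sum. All algebras `A` are treated at once because the step from `j + 1` to `j` applies the
induction hypothesis over the square-zero extension of `A`. -/
theorem hasPartitionRank_specialize_genericPoint (hm : 0 < m) (T : Tensor F (m + 1) n)
    (x₀ : Fin (m + 1) → Fin n → F) (j : Fin (m + 1)) :
    ∃ r : ℕ, 2 ^ (j : ℕ) * r =
        ∑ i : Fin m with j ≤ i.castSucc, 2 ^ (i : ℕ) * minorRank (genericSlice T x₀ i) ∧
      ∀ (A : Type u) [CommRing A] [Algebra F A] (φ : MvPolynomial (Fin m × Fin n) F →ₐ[F] A),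
        (∀ i, IsUnit (φ (maxMinor (genericSlice T x₀ i)))) →
        HasPartitionRank (Finset.Ici j)
          (specialize T j fun l a => φ (genericPoint T x₀ j l a)) r := by
  induction j using Fin.reverseInduction with
  | last =>
    refine ⟨0, ?_, fun A _ _ φ _ => ?_⟩
    · rw [mul_zero, Finset.filter_false_of_mem, Finset.sum_empty]
      intro i _
      simp
    -- The final step of the sweep put its coordinate in the kernel of the slice, so the fully
    -- specialised form vanishes.
    obtain ⟨i, hi⟩ : ∃ i : Fin m, i.succ = Fin.last m :=
      ⟨⟨m - 1, by omega⟩, by ext; simp; omega⟩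
    convert hasPartitionRank_zero (Finset.Ici (Fin.last m)) using 2 with z
    rw [← hi, map_genericPoint_succ]
    have h0 := genericSlice_mul_kernelMatrix T x₀ i
    apply_fun fun M => M.map φ at h0
    rw [Matrix.map_mul, map_kernelMatrix_genericSlice, genericSlice, map_slice] at h0
    set p := fun l a => φ (genericPoint T x₀ i.castSucc l a)
    set K := kernelMatrix (slice T p i.castSucc) (minorRows (genericSlice T x₀ i))
      (minorCols (genericSlice T x₀ i))
    have h1 := dotProduct_slice_mulVec T p (i.castSucc_lt_last.ne)
      (K *ᵥ fun a => φ (MvPolynomial.X (i, a))) (z (Fin.last m))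
    rw [Matrix.mulVec_mulVec, show slice T p i.castSucc * K = Matrix.map 0 φ from h0] at h1
    have h2 : (0 : Matrix (Fin n) (Fin n) (MvPolynomial (Fin m × Fin n) F)).map φ = 0 := by
      ext; simp
    rw [h2, Matrix.zero_mulVec, dotProduct_zero] at h1
    rw [h1, specialize]
    congr 1
    funext l
    by_cases hl : l = Fin.last m
    · subst hl
      simp [hi]
    · have : l < i.succ := hi ▸ Fin.lt_last_iff_ne_last.2 hl
      simp [hl, this]
  | cast i ih =>
    obtain ⟨r, hr, ih⟩ := ih
    refine ⟨minorRank (genericSlice T x₀ i) + 2 * r, ?_, fun A _ _ φ hφ => ?_⟩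
    · have : (Finset.univ.filter fun l : Fin m => i.castSucc ≤ l.castSucc) =
          insert i (Finset.univ.filter fun l : Fin m => i.succ ≤ l.castSucc) := by
        ext l
        simp only [Finset.mem_filter, Finset.mem_insert, Finset.mem_univ, true_and, Fin.le_def,
          Fin.val_castSucc, Fin.val_succ, Fin.ext_iff]
        omega
      rw [this, Finset.sum_insert (by simp), ← hr]
      simp only [Fin.val_castSucc, Fin.val_succ]
      ring
    have hU : Finset.Ici i.castSucc = insert i.castSucc (Finset.Ici i.succ) := by
      ext l
      simp only [Finset.mem_Ici, Finset.mem_insert, Fin.le_def, Fin.val_castSucc, Fin.val_succ,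
          Fin.ext_iff]
      omega
    have hc : i.castSucc ∉ Finset.Ici i.succ := by simp
    -- The minors remain units after perturbation, since being a unit is tested on the
    -- non-infinitesimal part.
    have h1 := ((ih _ (perturb i φ) fun l => by
      rw [TrivSqZeroExt.isUnit_iff_isUnit_fst, fst_perturb]
      exact hφ l)).derivative hc
    simp only [snd_specialize_perturb] at h1
    have hdet := map_maxMinor_genericSlice T x₀ i φ
    set p := fun l a => φ (genericPoint T x₀ i.castSucc l a)
    set I := minorRows (genericSlice T x₀ i)
    set J := minorCols (genericSlice T x₀ i)
    set M := slice T p i.castSucc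
    obtain ⟨d, hd⟩ := (hφ i).exists_left_inv
    -- The correction `δ z - K z` lies in the span of the `ρ_i` basis vectors `e_J`; each
    -- contributes a linear form in coordinate `i` times a form in the later ones. Here `d` is the
    -- inverse of the minor `δ`.
    have h2 : HasPartitionRank (Finset.Ici i.castSucc) (fun z : Fin (m + 1) → Fin n → A =>
        ∑ e, (d * ((M.submatrix I J).adjugate *ᵥ fun l => (M *ᵥ z i.castSucc) (I l)) e) *
          specialize T i.castSucc p (update z i.castSucc (Pi.single (J e) 1)))
        (minorRank (genericSlice T x₀ i)) := by
      refine ⟨Fin (minorRank (genericSlice T x₀ i)), inferInstance, fun _ => {i.castSucc},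
        fun e z => d * ((M.submatrix I J).adjugate *ᵥ fun l => (M *ᵥ z i.castSucc) (I l)) e,
        fun e z => specialize T i.castSucc p (update z i.castSucc (Pi.single (J e) 1)),
        by simp, fun e => ⟨by simp, ?_, by simp, ?_, ?_⟩, fun z => rfl⟩
      · refine ⟨Fin.last m, ?_⟩
        simp [Fin.le_last, i.castSucc_lt_last.ne']
      · refine IsFormOn.const_mul ⟨fun x y h => ?_, fun x l hl u v => ?_, fun x l hl c u => ?_⟩ d
        · rw [h _ (by simp)]
        · obtain rfl := Finset.mem_singleton.1 hl
          have : (fun l => (M *ᵥ u + M *ᵥ v) (I l)) =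
            (fun l => (M *ᵥ u) (I l)) + fun l => (M *ᵥ v) (I l) := rfl
          rw [update_self, update_self, update_self, Matrix.mulVec_add, this, Matrix.mulVec_add]
          rfl
        · obtain rfl := Finset.mem_singleton.1 hl
          have : (fun l => (c • M *ᵥ u) (I l)) = c • (fun l => (M *ᵥ u) (I l)) := rfl
          rw [update_self, update_self, Matrix.mulVec_smul, this, Matrix.mulVec_smul]
          rfl
      · have e1 : Finset.Ici i.castSucc \ {i.castSucc} = Finset.Ici i.succ := by
          rw [hU, Finset.insert_sdiff_of_mem _ (by simp), Finset.sdiff_singleton_eq_erase,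
            Finset.erase_eq_of_notMem hc]
        rw [e1]
        simp only [specialize_update]
        exact isFormOn_specialize T i.succ _
    rw [hU] at h2 ⊢
    convert h2.add (h1.const_mul d) using 2 with z
    -- Split `δ z` into `K z`, handled by the derivative, and the correction, handled by `h2`.
    have h3 := kernelMatrix_mulVec M I J (z i.castSucc)
    rw [hdet, eq_sub_iff_add_eq] at h3
    have h4 := congrArg (fun v => d * specialize T i.castSucc p (update z i.castSucc v)) h3
    simp only [specialize_update_add T le_rfl, specialize_update_sum T le_rfl,
      specialize_update_smul T le_rfl] at h4
    rw [← mul_assoc d (φ _), hd, one_mul, update_eq_self] at h4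
    rw [← h4, mul_add, add_comm, Finset.mul_sum]
    congr 1
    · exact Finset.sum_congr rfl fun e _ => (mul_assoc _ _ _).symm
    · have h5 : kernelMatrix M I J *ᵥ z i.castSucc =
          ∑ a, z i.castSucc a • (kernelMatrix M I J *ᵥ Pi.single a 1) := by
        funext b
        simp [Matrix.mulVec, dotProduct, mul_comm]
      rw [h5, specialize_update_sum T le_rfl]
      simp only [specialize_update_smul T le_rfl]

/-- The partition rank is bounded by the weighted sum of the ranks of the generic slices. -/
theorem partitionRank_le_sum_minorRank (hm : 0 < m) (T : Tensor F (m + 1) n)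
    (x₀ : Fin (m + 1) → Fin n → F) (y : Fin m × Fin n → F)
    (hy : ∀ i, MvPolynomial.eval y (maxMinor (genericSlice T x₀ i)) ≠ 0) :
    partitionRank T ≤ ∑ i : Fin m, 2 ^ (i : ℕ) * minorRank (genericSlice T x₀ i) := by
  obtain ⟨r, hr, h⟩ := hasPartitionRank_specialize_genericPoint hm T x₀ 0
  have := h F (MvPolynomial.aeval y) fun i => isUnit_iff_ne_zero.2 (by
    simpa [MvPolynomial.aeval_eq_eval] using hy i)
  have e : (Finset.Ici (0 : Fin (m + 1))) = Finset.univ := by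
    ext; simp
  rw [e] at this
  have h2 := HasPartitionRank.partitionRank_le (T := T) (r := r) (by
    convert this using 2 with z
    simp [specialize, baseChange_self])
  simpa [hr] using h2.trans (by simpa using hr.le)

end Sweep

/-! ### Counting in kernels of matrices over a finite field. -/

section Counting

/-- Exchanging `v` with the `i`-th coordinate of `x` is an involution on pairs. -/
theorem sum_sum_update {ι V : Type*} [Fintype ι] [DecidableEq ι] [Fintype V] (i : ι)
    (g : (ι → V) → ℝ) : ∑ x, ∑ v, g (update x i v) = Fintype.card V * ∑ x, g x := by
  have hinv : Function.Involutive fun p : (ι → V) × V => (update p.1 i p.2, p.1 i) := by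
    rintro ⟨x, v⟩
    simp
  rw [← Fintype.sum_prod_type' fun x v => g (update x i v)]
  refine (Equiv.sum_comp hinv.toPerm fun p => g p.1).trans ?_
  rw [Fintype.sum_prod_type]
  simp [Finset.mul_sum]

variable {F : Type*} [Field F] [Fintype F] [DecidableEq F] {n : ℕ}

/-- The number of elements of the kernel of a matrix. -/
noncomputable def kernelCard (M : Matrix (Fin n) (Fin n) F) : ℝ :=
  ∑ v : Fin n → F, if M *ᵥ v = 0 then 1 else 0

theorem kernelCard_mul_pow_rank (M : Matrix (Fin n) (Fin n) F) :
    kernelCard M * (Fintype.card F : ℝ) ^ M.rank = Fintype.card (Fin n → F) := by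
  have h1 := LinearMap.finrank_range_add_finrank_ker M.mulVecLin
  rw [Module.finrank_fin_fun] at h1
  have : Fintype (LinearMap.ker M.mulVecLin) := Fintype.ofFinite _
  have h2 := Module.card_eq_pow_finrank (K := F) (V := LinearMap.ker M.mulVecLin)
  have h3 : kernelCard M = Fintype.card (LinearMap.ker M.mulVecLin) := by
    rw [kernelCard, Finset.sum_boole, ← Fintype.card_subtype]
    norm_cast
    exact Fintype.card_congr (Equiv.subtypeEquivRight fun v => by simp)
  rw [h3, h2, Fintype.card_fun, Fintype.card_fin, Matrix.rank]
  push_cast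
  rw [← pow_add, add_comm, h1]

theorem kernelCard_pos (M : Matrix (Fin n) (Fin n) F) : 0 < kernelCard M := by
  have h := kernelCard_mul_pow_rank M
  have h1 : (0 : ℝ) < Fintype.card (Fin n → F) := by exact_mod_cast Fintype.card_pos
  have h2 : (0 : ℝ) < (Fintype.card F : ℝ) ^ M.rank := by
    have : 0 < Fintype.card F := Fintype.card_pos
    positivity
  exact pos_of_mul_pos_left (h ▸ h1) h2.le

/-- Averages over the kernel of `M` are averages over the image of a multiple of a projection. -/
theorem card_mul_sum_kernel {M P : Matrix (Fin n) (Fin n) F} {δ : F} (hδ : δ ≠ 0)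
    (hMP : M * P = 0) (hP : ∀ w, M *ᵥ w = 0 → P *ᵥ w = δ • w) (g : (Fin n → F) → ℝ) :
    Fintype.card (Fin n → F) * ∑ w, (if M *ᵥ w = 0 then g w else 0) =
      kernelCard M * ∑ v, g (P *ᵥ v) := by
  -- For fixed `v`, the bijection `w ↦ P v + δ w` preserves the kernel of `M`. For `w` in the kernel
  -- it equals `P (v + w)`, so summing over `v` removes the dependence on `w`.
  have h1 : ∀ v w : Fin n → F, M *ᵥ (P *ᵥ v + δ • w) = 0 ↔ M *ᵥ w = 0 := fun v w => by
    rw [Matrix.mulVec_add, Matrix.mulVec_mulVec, hMP, Matrix.zero_mulVec, zero_add,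
      Matrix.mulVec_smul, smul_eq_zero, or_iff_right hδ]
  have h2 : ∀ v : Fin n → F, ∑ w, (if M *ᵥ w = 0 then g w else 0) =
      ∑ w, if M *ᵥ w = 0 then g (P *ᵥ v + δ • w) else 0 := fun v => by
    let e : (Fin n → F) ≃ (Fin n → F) :=
      (LinearEquiv.smulOfNeZero F (Fin n → F) δ hδ).toEquiv.trans (Equiv.addLeft (P *ᵥ v))
    rw [← Equiv.sum_comp e]
    refine Finset.sum_congr rfl fun w _ => ?_
    have he : e w = P *ᵥ v + δ • w := rfl
    simp only [he, h1]
  calc _ = ∑ v, ∑ w, if M *ᵥ w = 0 then g (P *ᵥ v + δ • w) else 0 := by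
        rw [← Finset.sum_congr rfl fun v _ => h2 v]
        simp
    _ = ∑ w, (if M *ᵥ w = 0 then 1 else 0) * ∑ v, g (P *ᵥ v) := by
        rw [Finset.sum_comm]
        refine Finset.sum_congr rfl fun w _ => ?_
        by_cases hw : M *ᵥ w = 0
        · simp only [hw, if_true, one_mul]
          rw [← Equiv.sum_comp (Equiv.addRight w) fun v => g (P *ᵥ v)]
          simp [Matrix.mulVec_add, hP w hw]
        · simp [hw]
    _ = _ := by rw [← Finset.sum_mul, kernelCard]

end Counting

/-! ### The zero locus and the sweep at given parameters. -/

section Sweep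

variable {F : Type*} [Field F] {m n : ℕ}

/-- The tensor vanishes identically in the last argument. -/
def VanishesLast (T : Tensor F (m + 1) n) (x : Fin (m + 1) → Fin n → F) : Prop :=
  ∀ w, T (update x (Fin.last m) w) = 0

/-- The fibres of the zero locus in direction `j` are kernels of slices; both stationarity and the
moment identity rest on this. -/
theorem vanishesLast_update_iff (T : Tensor F (m + 1) n) (x : Fin (m + 1) → Fin n → F)
    {j : Fin (m + 1)} (hj : j ≠ Fin.last m) (v : Fin n → F) :
    VanishesLast T (update x j v) ↔ slice T x j *ᵥ v = 0 := by
  constructor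
  · intro h
    funext a
    rw [slice_mulVec T x hj, baseChange_self]
    exact h _
  · intro h w
    have := dotProduct_slice_mulVec T x hj v w
    rw [h, dotProduct_zero, baseChange_self] at this
    exact this.symm

/-- The generic point at the parameters `y`. -/
noncomputable def sweepPoint (T : Tensor F (m + 1) n) (x₀ : Fin (m + 1) → Fin n → F)
    (j : Fin (m + 1)) (y : Fin m → Fin n → F) : Fin (m + 1) → Fin n → F :=
  fun l a => MvPolynomial.aeval (fun p : Fin m × Fin n => y p.1 p.2) (genericPoint T x₀ j l a)

/-- The maximal minor of the generic slice at the parameters `y`. -/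
noncomputable def sweepMinor (T : Tensor F (m + 1) n) (x₀ : Fin (m + 1) → Fin n → F)
    (i : Fin m) (y : Fin m → Fin n → F) : F :=
  MvPolynomial.aeval (fun p : Fin m × Fin n => y p.1 p.2) (maxMinor (genericSlice T x₀ i))

theorem sweepPoint_update (T : Tensor F (m + 1) n) (x₀ : Fin (m + 1) → Fin n → F)
    {j : Fin (m + 1)} {i : Fin m} (h : j ≤ i.castSucc) (y : Fin m → Fin n → F) (v : Fin n → F) :
    sweepPoint T x₀ j (update y i v) = sweepPoint T x₀ j y := by
  refine map_genericPoint_congr T x₀ j fun l hl a => ?_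
  have : l ≠ i := by
    rintro rfl
    exact (hl.trans_le h).ne rfl
  simp [this]

theorem sweepMinor_update (T : Tensor F (m + 1) n) (x₀ : Fin (m + 1) → Fin n → F)
    {l i : Fin m} (h : l ≤ i) (y : Fin m → Fin n → F) (v : Fin n → F) :
    sweepMinor T x₀ l (update y i v) = sweepMinor T x₀ l y := by
  have := sweepPoint_update T x₀ (Fin.castSucc_le_castSucc_iff.2 h) y v
  rw [sweepMinor, sweepMinor, ← map_maxMinor_genericSlice, ← map_maxMinor_genericSlice]
  unfold sweepPoint at this
  rw [this]

theorem card_fun_pos [Fintype F] : (0 : ℝ) < Fintype.card (Fin n → F) := by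
  exact_mod_cast Fintype.card_pos

end Sweep

/-! ### The random sweep on the zero locus. -/

section Averages

variable {F : Type*} [Field F] [Fintype F] [DecidableEq F] {m n : ℕ}

instance (T : Tensor F (m + 1) n) : DecidablePred (VanishesLast T) := fun _ =>
  inferInstanceAs (Decidable (∀ _, _ = _))

/-- The average of `g` when the `j`-th argument is resampled in the kernel of the slice. -/
noncomputable def kernelAverage (T : Tensor F (m + 1) n) (j : Fin (m + 1))
    (g : (Fin (m + 1) → Fin n → F) → ℝ) (x : Fin (m + 1) → Fin n → F) : ℝ :=
  (∑ v, if slice T x j *ᵥ v = 0 then g (update x j v) else 0) / kernelCard (slice T x j)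

/-- The sum of `g` over the points where `T` vanishes identically in the last argument. -/
noncomputable def vanishingSum (T : Tensor F (m + 1) n)
    (g : (Fin (m + 1) → Fin n → F) → ℝ) : ℝ :=
  ∑ x, if VanishesLast T x then g x else 0

theorem card_mul_vanishingSum (T : Tensor F (m + 1) n) {j : Fin (m + 1)} (hj : j ≠ Fin.last m)
    (g : (Fin (m + 1) → Fin n → F) → ℝ) :
    Fintype.card (Fin n → F) * vanishingSum T g =
      ∑ x, ∑ v, if slice T x j *ᵥ v = 0 then g (update x j v) else 0 := by
  rw [vanishingSum, ← sum_sum_update j]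
  simp only [vanishesLast_update_iff T _ hj]

/-- Stationarity: the kernel average is constant along each fibre in direction `j`, with the same
total over the fibre as `g`. -/
theorem vanishingSum_kernelAverage (T : Tensor F (m + 1) n) {j : Fin (m + 1)}
    (hj : j ≠ Fin.last m) (g : (Fin (m + 1) → Fin n → F) → ℝ) :
    vanishingSum T (kernelAverage T j g) = vanishingSum T g := by
  refine mul_left_cancel₀ (card_fun_pos (F := F) (n := n)).ne' ?_
  rw [card_mul_vanishingSum T hj, card_mul_vanishingSum T hj]
  refine Finset.sum_congr rfl fun x _ => ?_
  have h : ∀ v, kernelAverage T j g (update x j v) = kernelAverage T j g x := fun v => by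
    simp [kernelAverage, slice_update_self]
  simp only [h]
  have h2 : ∀ v, (if slice T x j *ᵥ v = 0 then kernelAverage T j g x else 0) =
    (if slice T x j *ᵥ v = 0 then 1 else 0) * kernelAverage T j g x := fun v => by
      split_ifs <;> simp
  simp only [h2]
  rw [← Finset.sum_mul, ← kernelCard, kernelAverage, mul_div_cancel₀ _ (kernelCard_pos _).ne']

/-- By rank-nullity, the size of a fibre times `q ^ rank` does not depend on the fibre. -/
theorem vanishingSum_pow_rank (T : Tensor F (m + 1) n) {j : Fin (m + 1)} (hj : j ≠ Fin.last m) :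
    vanishingSum T (fun x => (Fintype.card F : ℝ) ^ (slice T x j).rank) =
      (Fintype.card (Fin n → F) : ℝ) ^ (m + 1) := by
  refine mul_left_cancel₀ (card_fun_pos (F := F) (n := n)).ne' ?_
  rw [card_mul_vanishingSum T hj]
  have : ∀ x : Fin (m + 1) → Fin n → F, (∑ v, if slice T x j *ᵥ v = 0 then
      (Fintype.card F : ℝ) ^ (slice T (update x j v) j).rank else 0) =
      Fintype.card (Fin n → F) := fun x => by
    rw [← kernelCard_mul_pow_rank (slice T x j), kernelCard, Finset.sum_mul]
    refine Finset.sum_congr rfl fun v _ => ?_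
    rw [slice_update_self]
    split_ifs <;> simp
  simp only [this]
  rw [Finset.sum_const, Finset.card_univ, Fintype.card_fun (α := Fin (m + 1)), Fintype.card_fin,
    nsmul_eq_mul]
  push_cast
  ring

theorem kernelAverage_nonneg (T : Tensor F (m + 1) n) (j : Fin (m + 1))
    {g : (Fin (m + 1) → Fin n → F) → ℝ} (hg : ∀ x, 0 ≤ g x) (x : Fin (m + 1) → Fin n → F) :
    0 ≤ kernelAverage T j g x := by
  refine div_nonneg (Finset.sum_nonneg fun v _ => ?_) (kernelCard_pos _).le
  split_ifs
  exacts [hg _, le_rfl]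

/-- The average of `g` after the arguments before `j` have been resampled in succession. -/
noncomputable def sweepAverage (T : Tensor F (m + 1) n) (j : Fin (m + 1)) :
    ((Fin (m + 1) → Fin n → F) → ℝ) → (Fin (m + 1) → Fin n → F) → ℝ :=
  Fin.induction (motive := fun _ => ((Fin (m + 1) → Fin n → F) → ℝ) →
    (Fin (m + 1) → Fin n → F) → ℝ) (fun g => g)
    (fun i E g => E (kernelAverage T i.castSucc g)) j

theorem sweepAverage_zero (T : Tensor F (m + 1) n) (g : (Fin (m + 1) → Fin n → F) → ℝ) :
    sweepAverage T 0 g = g := rfl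

theorem sweepAverage_succ (T : Tensor F (m + 1) n) (i : Fin m)
    (g : (Fin (m + 1) → Fin n → F) → ℝ) :
    sweepAverage T i.succ g = sweepAverage T i.castSucc (kernelAverage T i.castSucc g) := rfl

theorem vanishingSum_sweepAverage (T : Tensor F (m + 1) n) (j : Fin (m + 1))
    (g : (Fin (m + 1) → Fin n → F) → ℝ) :
    vanishingSum T (sweepAverage T j g) = vanishingSum T g := by
  induction j using Fin.induction generalizing g with
  | zero => rfl
  | succ i ih => rw [sweepAverage_succ, ih, vanishingSum_kernelAverage T i.castSucc_lt_last.ne]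

/-- While the minors are nonzero, `K v` with `v` uniform is uniform in the kernel, so the
parametrised sweep follows the random one. Parameters with a vanishing minor are discarded, which
costs only an inequality because `g` is nonnegative. -/
theorem sum_le_sweepAverage (T : Tensor F (m + 1) n) (x₀ : Fin (m + 1) → Fin n → F)
    (j : Fin (m + 1)) {g : (Fin (m + 1) → Fin n → F) → ℝ} (hg : ∀ x, 0 ≤ g x) :
    ∑ y : Fin m → Fin n → F, (if ∀ i : Fin m, i.castSucc < j → sweepMinor T x₀ i y ≠ 0 then
      g (sweepPoint T x₀ j y) else 0) ≤
      Fintype.card (Fin m → Fin n → F) * sweepAverage T j g x₀ := by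
  induction j using Fin.induction generalizing g with
  | zero =>
    have : ∀ y, sweepPoint T x₀ 0 y = x₀ := fun y => by
      funext l a
      simp [sweepPoint, genericPoint_zero]
    simp [this, sweepAverage_zero]
  | succ i ih =>
    refine le_trans ?_ (ih (kernelAverage_nonneg T i.castSucc hg))
    refine le_of_mul_le_mul_left ?_ (card_fun_pos (F := F) (n := n))
    -- Average over the `i`-th parameter alone; the point before step `i` and the minors up to `i`
    -- do not depend on it.
    rw [← sum_sum_update i, Finset.mul_sum]
    refine Finset.sum_le_sum fun y _ => ?_
    have hiff : ∀ v, (∀ l : Fin m, l.castSucc < i.succ → sweepMinor T x₀ l (update y i v) ≠ 0) ↔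
        (∀ l : Fin m, l.castSucc < i.castSucc → sweepMinor T x₀ l y ≠ 0) ∧
          sweepMinor T x₀ i y ≠ 0 := fun v => by
      constructor
      · intro h
        refine ⟨fun l hl => ?_, ?_⟩
        · rw [← sweepMinor_update T x₀ (Fin.castSucc_le_castSucc_iff.1 hl.le) y v]
          exact h l (hl.trans i.castSucc_lt_succ)
        · rw [← sweepMinor_update T x₀ le_rfl y v]
          exact h i i.castSucc_lt_succ
      · rintro ⟨h1, h2⟩ l hl
        have hl' : l ≤ i := Fin.castSucc_lt_succ_iff.1 hl
        rw [sweepMinor_update T x₀ hl']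
        rcases hl'.eq_or_lt with rfl | hlt
        exacts [h2, h1 l hlt]
    by_cases h1 : ∀ l : Fin m, l.castSucc < i.castSucc → sweepMinor T x₀ l y ≠ 0
    swap
    · simp only [hiff, h1, false_and, if_false, Finset.sum_const_zero, mul_zero, le_refl]
    by_cases h2 : sweepMinor T x₀ i y = 0
    · simp only [hiff, h2, ne_eq, not_true_eq_false, and_false, if_false, Finset.sum_const_zero]
      rw [if_pos h1]
      exact mul_nonneg (card_fun_pos (F := F) (n := n)).le (kernelAverage_nonneg T _ hg _)
    simp only [hiff, if_pos h1, ne_eq, h2, not_false_eq_true, and_true]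
    refine le_of_eq ?_
    have hMP := genericSlice_mul_kernelMatrix T x₀ i
    apply_fun fun M => M.map (MvPolynomial.aeval fun p : Fin m × Fin n => y p.1 p.2) at hMP
    rw [Matrix.map_mul, map_kernelMatrix_genericSlice] at hMP
    have hpt : ∀ v, sweepPoint T x₀ i.succ (update y i v) =
        update (sweepPoint T x₀ i.castSucc y) i.castSucc
          (kernelMatrix (slice T (sweepPoint T x₀ i.castSucc y) i.castSucc)
            (minorRows (genericSlice T x₀ i)) (minorCols (genericSlice T x₀ i)) *ᵥ v) :=
        fun v => by
      refine (map_genericPoint_succ T x₀ i _).trans ?_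
      have := sweepPoint_update T x₀ (le_refl i.castSucc) y v
      unfold sweepPoint at this
      rw [this]
      simp only [MvPolynomial.aeval_X, update_self]
      rfl
    have hdet := map_maxMinor_genericSlice T x₀ i
      (MvPolynomial.aeval fun p : Fin m × Fin n => y p.1 p.2)
    have hMP' : slice T (sweepPoint T x₀ i.castSucc y) i.castSucc *
        kernelMatrix (slice T (sweepPoint T x₀ i.castSucc y) i.castSucc)
          (minorRows (genericSlice T x₀ i)) (minorCols (genericSlice T x₀ i)) = 0 := by
      refine Eq.trans ?_ (hMP.trans ?_)
      · rw [genericSlice, map_slice]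
        rfl
      · ext; simp
    have := card_mul_sum_kernel (δ := sweepMinor T x₀ i y) h2 hMP'
      (fun w hw => by
        rw [kernelMatrix_mulVec_of_mulVec_eq_zero _ _ _ hw]
        congr 1)
      (fun v => g (update (sweepPoint T x₀ i.castSucc y) i.castSucc v))
    simp only [hpt]
    rw [kernelAverage, mul_div_assoc', eq_div_iff (kernelCard_pos _).ne', mul_comm _ (kernelCard _)]
    exact this.symm

end Averages

/-! ### Bias, analytic rank and average slice ranks. -/

section Bias

variable {F : Type*} [Field F] {m n : ℕ}

theorem card_mul_bias [Fintype F] [DecidableEq F] (T : Tensor F (m + 1) n) :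
    (Fintype.card (Fin n → F) : ℝ) ^ (m + 1) * bias T = vanishingSum T 1 := by
  have hN := card_fun_pos (F := F) (n := n)
  have hcard : ∀ c : F, (Nat.card {x : Fin (m + 1) → Fin n → F // T x = c} : ℝ) =
      ∑ x, if T x = c then 1 else 0 := fun c => by
    rw [Finset.sum_boole, Nat.card_eq_fintype_card, Fintype.card_subtype]
  have htot : (Nat.card (Fin (m + 1) → Fin n → F) : ℝ) =
      (Fintype.card (Fin n → F) : ℝ) ^ (m + 1) := by
    rw [Nat.card_eq_fintype_card, Fintype.card_fun (α := Fin (m + 1)), Fintype.card_fin]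
    push_cast
    rfl
  rw [bias, hcard, hcard, htot, ← sub_div, mul_div_cancel₀ _ (by positivity),
    ← Finset.sum_sub_distrib]
  refine mul_left_cancel₀ hN.ne' ?_
  rw [← sum_sum_update (Fin.last m), vanishingSum, Finset.mul_sum]
  refine Finset.sum_congr rfl fun x _ => ?_
  by_cases h : VanishesLast T x
  · have h' := h
    unfold VanishesLast at h'
    simp [h, h']
  · rw [if_neg h, mul_zero, Finset.sum_sub_distrib, sub_eq_zero]
    unfold VanishesLast at h
    push Not at h
    obtain ⟨w, hw⟩ := h
    -- A nonzero linear form takes the values `0` and `1` equally often: translate by a vector on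
    -- which it equals `1`.
    rw [← Equiv.sum_comp (Equiv.addRight ((T (update x (Fin.last m) w))⁻¹ • w))
      fun v => if T (update x (Fin.last m) v) = 1 then (1 : ℝ) else 0]
    simp [T.map_update_add, T.map_update_smul, hw]

theorem vanishingSum_one_pos [Fintype F] [DecidableEq F] (hm : 0 < m) (T : Tensor F (m + 1) n) :
    0 < vanishingSum T 1 := by
  have h0 : VanishesLast T 0 := fun w =>
    T.map_coord_zero ⟨0, hm.trans (Nat.lt_succ_self m)⟩ (by
      rw [update_of_ne (by simp [Fin.ext_iff]; omega)]
      rfl)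
  rw [vanishingSum]
  refine Finset.sum_pos' (fun x _ => by split_ifs <;> simp) ⟨0, Finset.mem_univ _, by simp [h0]⟩

theorem one_lt_card_real [Fintype F] : (1 : ℝ) < Fintype.card F := by
  exact_mod_cast Fintype.one_lt_card

theorem vanishingSum_one_eq [Fintype F] [DecidableEq F] (hm : 0 < m) (T : Tensor F (m + 1) n) :
    vanishingSum T 1 = (Fintype.card (Fin n → F) : ℝ) ^ (m + 1) *
      (Fintype.card F : ℝ) ^ (-analyticRank T) := by
  have hq := one_lt_card_real (F := F)
  have hb : 0 < bias T := by
    have h := vanishingSum_one_pos hm T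
    rw [← card_mul_bias] at h
    exact pos_of_mul_pos_right h (by positivity)
  rw [← card_mul_bias, analyticRank, neg_neg, Nat.card_eq_fintype_card,
    Real.rpow_logb (by linarith) hq.ne' hb]

/-- The average rank of a slice over the zero locus is at most the analytic rank. -/
theorem vanishingSum_rank_le [Fintype F] [DecidableEq F] (hm : 0 < m) (T : Tensor F (m + 1) n)
    {j : Fin (m + 1)} (hj : j ≠ Fin.last m) :
    vanishingSum T (fun x => ((slice T x j).rank : ℝ)) ≤ vanishingSum T 1 * analyticRank T := by
  have hq := one_lt_card_real (F := F)
  have hlog := Real.log_pos hq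
  have hq0 : (0 : ℝ) < Fintype.card F := by linarith
  set q := (Fintype.card F : ℝ)
  set A := analyticRank T
  have h1 : vanishingSum T (fun x => q ^ (slice T x j).rank) * q ^ (-A) = vanishingSum T 1 := by
    rw [vanishingSum_pow_rank T hj, vanishingSum_one_eq hm]
  -- Pointwise this is `1 + u ≤ exp u` with `u = log q * (rank - A)`.
  have h2 : vanishingSum T 1 + Real.log q * (vanishingSum T (fun x => ((slice T x j).rank : ℝ)) -
      vanishingSum T 1 * A) ≤ vanishingSum T (fun x => q ^ (slice T x j).rank) * q ^ (-A) := by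
    simp only [vanishingSum, Finset.sum_mul, ← Finset.sum_sub_distrib, Finset.mul_sum,
      ← Finset.sum_add_distrib]
    refine Finset.sum_le_sum fun x _ => ?_
    split_ifs
    · rw [← Real.rpow_natCast, ← Real.rpow_add hq0, Real.rpow_def_of_pos hq0]
      have := Real.add_one_le_exp (Real.log q * ((slice T x j).rank + -A))
      simp only [Pi.one_apply]
      linarith
    · simp
  rw [h1] at h2
  have h3 : Real.log q * (vanishingSum T (fun x => ((slice T x j).rank : ℝ)) -
      vanishingSum T 1 * A) ≤ 0 := by linarith
  have := nonpos_of_mul_nonpos_right h3 hlog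
  linarith

theorem analyticRank_nonneg [Fintype F] [DecidableEq F] (hm : 0 < m) (T : Tensor F (m + 1) n) :
    0 ≤ analyticRank T := by
  have h := vanishingSum_rank_le hm T (j := ⟨0, by omega⟩) (by simp [Fin.ext_iff]; omega)
  have h0 : 0 ≤ vanishingSum T (fun x => ((slice T x (⟨0, by omega⟩ : Fin (m + 1))).rank : ℝ)) :=
    Finset.sum_nonneg fun x _ => by split_ifs <;> positivity
  exact nonneg_of_mul_nonneg_right (h0.trans h) (vanishingSum_one_pos hm T)

/-- Some starting point has small weighted average ranks along the sweep. -/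
theorem exists_sum_sweepAverage_le [Fintype F] [DecidableEq F] (hm : 0 < m)
    (T : Tensor F (m + 1) n) : ∃ x₀, ∑ i : Fin m, (2 : ℝ) ^ (i : ℕ) *
      sweepAverage T i.castSucc (fun x => ((slice T x i.castSucc).rank : ℝ)) x₀ ≤
        (2 ^ m - 1) * analyticRank T := by
  by_contra! h
  have h1 : vanishingSum T (fun x₀ => ∑ i : Fin m, (2 : ℝ) ^ (i : ℕ) *
      sweepAverage T i.castSucc (fun x => ((slice T x i.castSucc).rank : ℝ)) x₀) =
      ∑ i : Fin m, (2 : ℝ) ^ (i : ℕ) *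
        vanishingSum T (fun x => ((slice T x i.castSucc).rank : ℝ)) := by
    rw [Finset.sum_congr rfl fun (i : Fin m) _ => congrArg ((2 : ℝ) ^ (i : ℕ) * ·)
      (vanishingSum_sweepAverage T i.castSucc fun x => ((slice T x i.castSucc).rank : ℝ)).symm]
    simp only [vanishingSum, Finset.mul_sum]
    rw [Finset.sum_comm]
    refine Finset.sum_congr rfl fun x _ => ?_
    split_ifs <;> simp
  have h2 : ∑ i : Fin m, (2 : ℝ) ^ (i : ℕ) = 2 ^ m - 1 := by
    rw [Fin.sum_univ_eq_sum_range fun i => (2 : ℝ) ^ i, geom_sum_eq (by norm_num)]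
    norm_num
  have h3 : vanishingSum T (fun x₀ => ∑ i : Fin m, (2 : ℝ) ^ (i : ℕ) *
      sweepAverage T i.castSucc (fun x => ((slice T x i.castSucc).rank : ℝ)) x₀) ≤
      vanishingSum T 1 * ((2 ^ m - 1) * analyticRank T) := by
    rw [h1, ← h2, Finset.sum_mul, Finset.mul_sum]
    refine Finset.sum_le_sum fun i _ => ?_
    have := vanishingSum_rank_le hm T i.castSucc_lt_last.ne
    calc _ ≤ (2 : ℝ) ^ (i : ℕ) * (vanishingSum T 1 * analyticRank T) := by gcongr
      _ = _ := by ring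
  have h4 := vanishingSum_one_pos hm T
  refine h3.not_gt ?_
  rw [vanishingSum, vanishingSum, Finset.sum_mul]
  -- A point of the zero locus makes the summed inequality strict.
  obtain ⟨x, hx⟩ : ∃ x, VanishesLast T x := by
    by_contra! hc
    simp [vanishingSum, hc] at h4
  refine Finset.sum_lt_sum (fun x _ => ?_) ⟨x, Finset.mem_univ _, ?_⟩
  · split_ifs
    · simpa using (h x).le
    · simp
  · simpa [hx] using h x

end Bias

/-! ### Degree bounds for the sweep, and Schwartz–Zippel. -/

section Degrees

variable {F : Type*} [Field F] {m n : ℕ} {σ : Type*}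

theorem totalDegree_det_le {ρ d : ℕ} (M : Matrix (Fin ρ) (Fin ρ) (MvPolynomial σ F))
    (h : ∀ a b, (M a b).totalDegree ≤ d) : M.det.totalDegree ≤ ρ * d := by
  rw [Matrix.det_apply]
  refine MvPolynomial.totalDegree_finsetSum_le fun τ _ => ?_
  have h1 : (∏ i, M (τ i) i).totalDegree ≤ ρ * d := by
    refine (MvPolynomial.totalDegree_finsetProd _ _).trans ?_
    refine (Finset.sum_le_sum fun i _ => h (τ i) i).trans (by simp)
  rcases Int.units_eq_one_or (Equiv.Perm.sign τ) with e | e <;> simpa [e] using h1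

theorem totalDegree_slice_le (T : Tensor F (m + 1) n)
    (p : Fin (m + 1) → Fin n → MvPolynomial σ F) (e : Fin (m + 1) → ℕ)
    (he : ∀ l a, (p l a).totalDegree ≤ e l) (j : Fin (m + 1)) (a b : Fin n) :
    (slice T p j a b).totalDegree ≤ ∑ l, e l := by
  rw [slice, Matrix.of_apply, baseChange_apply]
  refine MvPolynomial.totalDegree_finsetSum_le fun τ _ => ?_
  refine (MvPolynomial.totalDegree_mul _ _).trans ?_
  rw [MvPolynomial.algebraMap_eq, MvPolynomial.totalDegree_C, zero_add]
  refine (MvPolynomial.totalDegree_finsetProd _ _).trans (Finset.sum_le_sum fun l _ => ?_)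
  by_cases h : l = Fin.last m
  · subst h
    simp only [update_self, Pi.single_apply]
    split_ifs <;> simp
  · by_cases h' : l = j
    · subst h'
      simp only [update_of_ne h, update_self, Pi.single_apply]
      split_ifs <;> simp
    · simpa [h, h'] using he l (τ l)

theorem totalDegree_mulVec_le {a b d d' : ℕ} (M : Matrix (Fin a) (Fin b) (MvPolynomial σ F))
    (v : Fin b → MvPolynomial σ F) (hM : ∀ i j, (M i j).totalDegree ≤ d)
    (hv : ∀ j, (v j).totalDegree ≤ d') (i : Fin a) : ((M *ᵥ v) i).totalDegree ≤ d + d' :=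
  MvPolynomial.totalDegree_finsetSum_le fun j _ =>
    (MvPolynomial.totalDegree_mul _ _).trans (add_le_add (hM i j) (hv j))

theorem totalDegree_adjugate_le {ρ d : ℕ} (M : Matrix (Fin ρ) (Fin ρ) (MvPolynomial σ F))
    (h : ∀ a b, (M a b).totalDegree ≤ d) (a b : Fin ρ) :
    (M.adjugate a b).totalDegree ≤ ρ * d := by
  rw [Matrix.adjugate_apply]
  refine totalDegree_det_le _ fun i j => ?_
  rw [Matrix.updateRow_apply]
  split_ifs
  · rw [Pi.single_apply]
    split_ifs <;> simp
  · exact h i j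

theorem totalDegree_kernelMatrix_mulVec_le {ρ d : ℕ}
    (M : Matrix (Fin n) (Fin n) (MvPolynomial σ F)) (h : ∀ a b, (M a b).totalDegree ≤ d)
    (I J : Fin ρ → Fin n) (v : Fin n → MvPolynomial σ F) (hv : ∀ a, (v a).totalDegree ≤ 1)
    (a : Fin n) : ((kernelMatrix M I J *ᵥ v) a).totalDegree ≤ (ρ + 1) * d + 1 := by
  rw [kernelMatrix_mulVec, Pi.sub_apply, Finset.sum_apply]
  refine (MvPolynomial.totalDegree_sub _ _).trans (max_le ?_ ?_)
  · rw [Pi.smul_apply, smul_eq_mul]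
    refine (MvPolynomial.totalDegree_mul _ _).trans ?_
    have := totalDegree_det_le (M.submatrix I J) fun _ _ => h _ _
    have := hv a
    nlinarith
  · refine MvPolynomial.totalDegree_finsetSum_le fun e _ => ?_
    have h1 := totalDegree_mulVec_le _ _ (totalDegree_adjugate_le (M.submatrix I J)
      fun _ _ => h _ _) (fun l => totalDegree_mulVec_le M v h hv (I l)) e
    rw [Pi.smul_apply, smul_eq_mul]
    refine (MvPolynomial.totalDegree_mul _ _).trans ?_
    have h2 : ((Pi.single (J e) 1 : Fin n → MvPolynomial σ F) a).totalDegree = 0 := by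
      rw [Pi.single_apply]
      split_ifs <;> simp
    nlinarith

theorem exists_totalDegree_genericPoint_le (T : Tensor F (m + 1) n)
    (x₀ : Fin (m + 1) → Fin n → F) (s : ℕ) (j : Fin (m + 1))
    (hs : ∀ i : Fin m, i.castSucc < j → minorRank (genericSlice T x₀ i) ≤ s) :
    ∃ e : Fin (m + 1) → ℕ, (∀ l a, (genericPoint T x₀ j l a).totalDegree ≤ e l) ∧
      ∑ l, e l ≤ ∑ i ∈ Finset.range j, (s + 2) ^ i := by
  induction j using Fin.induction with
  | zero => exact ⟨0, by simp [genericPoint_zero], by simp⟩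
  | succ i ih =>
    obtain ⟨e, he, hsum⟩ := ih fun l hl => hs l (hl.trans i.castSucc_lt_succ)
    -- A slice is multilinear in the point, so its entries have degree at most `∑ e`; the kernel
    -- matrix adds a factor `s + 1` and the fresh variable adds `1`. The new total is at most `(s +
    -- 2) * ∑ e + 1`, which is the recursion of the geometric sum.
    refine ⟨update e i.castSucc ((s + 1) * (∑ l, e l) + 1), fun l a => ?_, ?_⟩
    · rw [genericPoint_succ]
      by_cases hl : l = i.castSucc
      · subst hl
        simp only [update_self]
        refine (totalDegree_kernelMatrix_mulVec_le (d := ∑ l, e l) _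
          (totalDegree_slice_le T _ e he _) _ _ _ (fun a => by simp) a).trans ?_
        have := hs i i.castSucc_lt_succ
        gcongr
      · simpa [hl] using he l a
    · rw [Finset.sum_update_of_mem (Finset.mem_univ _), Fin.val_succ, geom_sum_succ]
      have : ∑ l ∈ Finset.univ \ {i.castSucc}, e l ≤ ∑ l, e l :=
        Finset.sum_le_sum_of_subset Finset.sdiff_subset
      simp only [Fin.val_castSucc] at hsum
      nlinarith

theorem totalDegree_minor_genericSlice_le (T : Tensor F (m + 1) n)
    (x₀ : Fin (m + 1) → Fin n → F) (s : ℕ) (j : Fin m)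
    (hs : ∀ i < j, minorRank (genericSlice T x₀ i) ≤ s) {t : ℕ} (ht : t ≤ s)
    (I J : Fin t → Fin n) :
    (((genericSlice T x₀ j).submatrix I J).det).totalDegree ≤ (s + 2) ^ (m - 1) := by
  obtain ⟨e, he, hsum⟩ := exists_totalDegree_genericPoint_le T x₀ s j.castSucc
    fun i hi => hs i (Fin.castSucc_lt_castSucc_iff.1 hi)
  refine (totalDegree_det_le (d := ∑ l, e l) _ fun a b =>
    totalDegree_slice_le T _ e he _ _ _).trans ?_
  have h1 := geom_sum_mul_add (s + 1) (j : ℕ)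
  simp only [Fin.val_castSucc] at hsum
  have h2 : (s + 2) ^ (j : ℕ) ≤ (s + 2) ^ (m - 1) := Nat.pow_le_pow_right (by omega) (by omega)
  calc t * ∑ l, e l ≤ (s + 1) * ∑ i ∈ Finset.range j, (s + 1 + 1) ^ i := by
        gcongr
        omega
    _ ≤ (s + 2) ^ (j : ℕ) := by
        rw [mul_comm]
        exact (Nat.le_succ _).trans h1.le
    _ ≤ _ := h2

/-- The Schwartz–Zippel bound for the parameters of the sweep. -/
theorem card_mul_le_card_filter_ne_zero [Fintype F] [DecidableEq F]
    {f : MvPolynomial (Fin m × Fin n) F} (hf : f ≠ 0) {D : ℕ} (hD : f.totalDegree ≤ D) :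
    (Fintype.card (Fin m → Fin n → F) : ℝ) * (1 - D / Fintype.card F) ≤
      (Finset.univ.filter fun y : Fin m → Fin n → F =>
        MvPolynomial.aeval (fun p : Fin m × Fin n => y p.1 p.2) f ≠ 0).card := by
  let ε : Fin m × Fin n ≃ Fin (m * n) := finProdFinEquiv
  have hf' : MvPolynomial.rename ε f ≠ 0 := fun h =>
    hf (MvPolynomial.rename_injective _ ε.injective (by simpa using h))
  have h1 := MvPolynomial.schwartz_zippel_totalDegree hf' (Finset.univ : Finset F)
  have h2 : (Finset.filter (fun x => MvPolynomial.eval x (MvPolynomial.rename ε f) = 0)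
      (Fintype.piFinset fun _ => (Finset.univ : Finset F))).card =
      (Finset.univ.filter fun y : Fin m → Fin n → F =>
        MvPolynomial.aeval (fun p : Fin m × Fin n => y p.1 p.2) f = 0).card := by
    rw [Fintype.piFinset_univ]
    let E : (Fin (m * n) → F) ≃ (Fin m → Fin n → F) :=
      (Equiv.arrowCongr ε.symm (Equiv.refl F)).trans (Equiv.curry _ _ _)
    refine Finset.card_equiv E fun x => ?_
    rw [Finset.mem_filter, Finset.mem_filter, MvPolynomial.eval_rename,
      MvPolynomial.aeval_eq_eval]
    simp only [Finset.mem_univ, true_and]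
    rfl
  have h3 : (Fintype.card (Fin m → Fin n → F) : ℝ) = (Fintype.card F : ℝ) ^ (m * n) := by
    simp [pow_mul, mul_comm m n]
  rw [h2, Finset.card_univ] at h1
  have h4 := (NNRat.cast_le (K := ℝ)).2 h1
  push_cast at h4
  have hq := one_lt_card_real (F := F)
  have h5 := Finset.card_filter_add_card_filter_not (s := (Finset.univ : Finset (Fin m → Fin n → F)))
    fun y => MvPolynomial.aeval (fun p : Fin m × Fin n => y p.1 p.2) f = 0
  rw [Finset.card_univ] at h5
  have h6 : (f.totalDegree : ℝ) ≤ D := by exact_mod_cast hD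
  rw [← h3, div_le_iff₀ (by exact_mod_cast Fintype.card_pos)] at h4
  have h7 : ((MvPolynomial.rename ε f).totalDegree : ℝ) / Fintype.card F ≤ D / Fintype.card F := by
    gcongr
    exact (MvPolynomial.totalDegree_rename_le _ _).trans hD
  have h8 : (0 : ℝ) < Fintype.card (Fin m → Fin n → F) := by exact_mod_cast Fintype.card_pos
  have h9 := mul_le_mul_of_nonneg_right h7 h8.le
  have h10 : ((Finset.univ.filter fun y : Fin m → Fin n → F =>
      MvPolynomial.aeval (fun p : Fin m × Fin n => y p.1 p.2) f = 0).card : ℝ) +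
      (Finset.univ.filter fun y : Fin m → Fin n → F =>
        ¬ MvPolynomial.aeval (fun p : Fin m × Fin n => y p.1 p.2) f = 0).card =
      Fintype.card (Fin m → Fin n → F) := by exact_mod_cast h5
  simp only [ne_eq]
  linarith

end Degrees

/-! ### Comparison of generic and average ranks, and the choice of constants. -/

section Main

variable {F : Type*} [Field F] [Fintype F] [DecidableEq F] {m n : ℕ}

/-- The average rank along the sweep is almost bounded below by the generic rank. -/
theorem mul_le_sweepAverage_rank (T : Tensor F (m + 1) n) (x₀ : Fin (m + 1) → Fin n → F)
    {s t : ℕ} (j : Fin m) (hs : ∀ i < j, minorRank (genericSlice T x₀ i) ≤ s) (hts : t ≤ s)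
    (ht : t ≤ minorRank (genericSlice T x₀ j)) :
    t * (1 - (m * (s + 2) ^ (m - 1) : ℕ) / Fintype.card F : ℝ) ≤
      sweepAverage T j.castSucc (fun x => ((slice T x j.castSucc).rank : ℝ)) x₀ := by
  obtain ⟨I, J, hIJ⟩ := exists_minor_ne_zero (genericSlice T x₀ j) ht
  set f := ((genericSlice T x₀ j).submatrix I J).det
  -- Where `g` is nonzero, the earlier steps are nondegenerate and the slice at step `j` has rank at
  -- least `t`.
  set g := f * ∏ i ∈ Finset.Iio j, maxMinor (genericSlice T x₀ i) with hg
  have hg0 : g ≠ 0 := mul_ne_zero hIJ (Finset.prod_ne_zero_iff.2 fun i _ => maxMinor_ne_zero _)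
  have hdeg : g.totalDegree ≤ m * (s + 2) ^ (m - 1) := by
    have hprod : (∏ i ∈ Finset.Iio j,
        maxMinor (genericSlice T x₀ i)).totalDegree ≤ j * (s + 2) ^ (m - 1) := by
      refine (MvPolynomial.totalDegree_finsetProd _ _).trans ?_
      refine (Finset.sum_le_card_nsmul _ _ ((s + 2) ^ (m - 1)) fun i hi => ?_).trans (by simp)
      have hij : i < j := by simpa using hi
      exact totalDegree_minor_genericSlice_le T x₀ s i (fun l hl => hs l (hl.trans hij))
        (hs i hij) _ _
    calc g.totalDegree ≤ (s + 2) ^ (m - 1) + j * (s + 2) ^ (m - 1) :=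
          (MvPolynomial.totalDegree_mul _ _).trans
            (add_le_add (totalDegree_minor_genericSlice_le T x₀ s j hs hts I J) hprod)
      _ = (j + 1) * (s + 2) ^ (m - 1) := by ring
      _ ≤ _ := Nat.mul_le_mul_right _ j.2
  have h1 := card_mul_le_card_filter_ne_zero hg0 hdeg
  have h2 := sum_le_sweepAverage T x₀ j.castSucc
    (g := fun x => ((slice T x j.castSucc).rank : ℝ)) fun x => Nat.cast_nonneg _
  have hN : (0 : ℝ) < Fintype.card (Fin m → Fin n → F) := by exact_mod_cast Fintype.card_pos
  refine le_of_mul_le_mul_left ?_ hN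
  refine le_trans ?_ h2
  calc _ = t * ((Fintype.card (Fin m → Fin n → F) : ℝ) *
        (1 - (m * (s + 2) ^ (m - 1) : ℕ) / Fintype.card F)) := by ring
    _ ≤ t * (Finset.univ.filter fun y : Fin m → Fin n → F =>
        MvPolynomial.aeval (fun p : Fin m × Fin n => y p.1 p.2) g ≠ 0).card := by gcongr
    _ = ∑ y : Fin m → Fin n → F,
        if MvPolynomial.aeval (fun p : Fin m × Fin n => y p.1 p.2) g ≠ 0 then (t : ℝ) else 0 := by
        rw [← Finset.sum_filter, Finset.sum_const, nsmul_eq_mul, mul_comm]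
    _ ≤ _ := by
        refine Finset.sum_le_sum fun y _ => ?_
        split_ifs with ha hb hb
        · rw [hg, map_mul] at ha
          have hf := left_ne_zero_of_mul ha
          have h3 := le_rank_of_minor_ne_zero (slice T (sweepPoint T x₀ j.castSucc y) j.castSucc)
            I J (by
              have := map_slice T (MvPolynomial.aeval fun p : Fin m × Fin n => y p.1 p.2)
                (genericPoint T x₀ j.castSucc) j.castSucc
              rw [AlgHom.map_det] at hf
              unfold sweepPoint
              rw [← this]
              exact hf)
          exact_mod_cast h3
        · refine absurd (fun i hi => ?_) hb
          rw [hg, map_mul, map_prod] at ha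
          exact Finset.prod_ne_zero_iff.1 (right_ne_zero_of_mul ha) i
            (by simpa using Fin.castSucc_lt_castSucc_iff.1 hi)
        · positivity
        · exact le_rfl

theorem sweepAverage_nonneg (T : Tensor F (m + 1) n) (j : Fin (m + 1))
    {g : (Fin (m + 1) → Fin n → F) → ℝ} (hg : ∀ x, 0 ≤ g x) (x : Fin (m + 1) → Fin n → F) :
    0 ≤ sweepAverage T j g x := by
  induction j using Fin.induction generalizing g with
  | zero => exact hg x
  | succ i ih => exact ih (kernelAverage_nonneg T i.castSucc hg)

theorem partitionRank_mul_le (hm : 0 < m) (T : Tensor F (m + 1) n) (s : ℕ)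
    (hs : (2 : ℝ) * ((2 ^ m - 1) * analyticRank T) < s)
    (hq : (2 : ℝ) * (m * (s + 2) ^ (m - 1) : ℕ) ≤ Fintype.card F) :
    partitionRank T * (1 - (m * (s + 2) ^ (m - 1) : ℕ) / Fintype.card F : ℝ) ≤
      (2 ^ m - 1) * analyticRank T := by
  obtain ⟨x₀, hx⟩ := exists_sum_sweepAverage_le hm T
  set D : ℕ := m * (s + 2) ^ (m - 1)
  have hq1 := one_lt_card_real (F := F)
  have hδ : (D : ℝ) / Fintype.card F ≤ 1 / 2 := by
    rw [div_le_div_iff₀ (by linarith) (by norm_num)]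
    linarith
  set E := fun i : Fin m =>
    sweepAverage T i.castSucc (fun x => ((slice T x i.castSucc).rank : ℝ)) x₀
  have hE : ∀ i, 0 ≤ E i := fun i => sweepAverage_nonneg T _ (fun x => Nat.cast_nonneg _) _
  have hEle : ∀ i, E i ≤ (2 ^ m - 1) * analyticRank T := fun i => by
    refine le_trans ?_ hx
    calc E i ≤ 2 ^ (i : ℕ) * E i := le_mul_of_one_le_left (hE i) (one_le_pow₀ (by norm_num))
      _ ≤ _ := Finset.single_le_sum (f := fun i : Fin m => (2 : ℝ) ^ (i : ℕ) * E i)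
        (fun i _ => mul_nonneg (by positivity) (hE i)) (Finset.mem_univ i)
  -- The degree bound presupposes a cap on the earlier ranks, hence strong induction. If the cap
  -- failed at `i`, a minor of size exactly `s` would give expected rank at least `s / 2`, more than
  -- `(2 ^ m - 1) AR(T)`.
  have hcap : ∀ i, minorRank (genericSlice T x₀ i) ≤ s := fun i => by
    induction i using WellFoundedLT.induction with
    | ind i ih =>
      by_contra! hc
      have h1 := mul_le_sweepAverage_rank T x₀ i ih le_rfl hc.le
      have h2 : (s : ℝ) * (1 / 2) ≤ s * (1 - (D : ℝ) / Fintype.card F) := by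
        gcongr
        linarith
      have h3 := hEle i
      have h4 := h2.trans (h1.trans h3)
      linarith
  have hlow : ∀ i, (minorRank (genericSlice T x₀ i) : ℝ) * (1 - (D : ℝ) / Fintype.card F) ≤ E i :=
    fun i => mul_le_sweepAverage_rank T x₀ i (fun l _ => hcap l) (hcap i) le_rfl
  have hprod0 : ∏ i, maxMinor (genericSlice T x₀ i) ≠ 0 :=
    Finset.prod_ne_zero_iff.2 fun i _ => maxMinor_ne_zero _
  have hdeg : (∏ i, maxMinor (genericSlice T x₀ i)).totalDegree ≤ D := by
    refine (MvPolynomial.totalDegree_finsetProd _ _).trans ?_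
    refine (Finset.sum_le_card_nsmul _ _ ((s + 2) ^ (m - 1)) fun i _ => ?_).trans (by simp [D])
    exact totalDegree_minor_genericSlice_le T x₀ s i (fun l _ => hcap l) (hcap i) _ _
  have hcount := card_mul_le_card_filter_ne_zero hprod0 hdeg
  have hN : (0 : ℝ) < Fintype.card (Fin m → Fin n → F) := by exact_mod_cast Fintype.card_pos
  -- Since `D / q ≤ 1 / 2`, some `F`-point avoids the zeros of all the maximal minors.
  obtain ⟨y, hy⟩ := Finset.card_pos.1 (Nat.cast_pos.1
    (lt_of_lt_of_le (mul_pos hN (by linarith)) hcount))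
  rw [Finset.mem_filter, map_prod, Finset.prod_ne_zero_iff] at hy
  have hPR := partitionRank_le_sum_minorRank hm T x₀ (fun p => y p.1 p.2) fun i => by
    simpa [MvPolynomial.aeval_eq_eval] using hy.2 i (Finset.mem_univ i)
  calc _ ≤ ((∑ i : Fin m, 2 ^ (i : ℕ) * minorRank (genericSlice T x₀ i) : ℕ) : ℝ) *
        (1 - (D : ℝ) / Fintype.card F) := by
        gcongr
        linarith
    _ = ∑ i : Fin m, 2 ^ (i : ℕ) * ((minorRank (genericSlice T x₀ i) : ℝ) *
        (1 - (D : ℝ) / Fintype.card F)) := by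
        push_cast
        rw [Finset.sum_mul]
        simp only [mul_assoc]
    _ ≤ ∑ i : Fin m, 2 ^ (i : ℕ) * E i := by
        gcongr with i
        exact hlow i
    _ ≤ _ := hx

theorem partitionRank_le_of_card_le (hm : 0 < m) (T : Tensor F (m + 1) n) {ε : ℝ} (hε : 0 < ε)
    (hε1 : ε ≤ 1)
    (hq : 2 ^ (m + 1) * (m * (2 ^ (m + 2)) ^ (m - 1)) * (analyticRank T + 1) ^ (m - 1) / ε ≤
      (Fintype.card F : ℝ)) :
    (partitionRank T : ℝ) ≤ (2 ^ m - 1 + ε) * analyticRank T := by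
  have hA := analyticRank_nonneg hm T
  set A := analyticRank T
  set q := (Fintype.card F : ℝ) with hqdef
  have hq1 : 1 < q := one_lt_card_real
  have h2m : (1 : ℝ) ≤ 2 ^ m := one_le_pow₀ (by norm_num)
  set s := ⌊2 * ((2 ^ m - 1) * A)⌋₊ + 1
  have hs : (2 : ℝ) * ((2 ^ m - 1) * A) < s := by
    push_cast [s]
    exact Nat.lt_floor_add_one _
  have hs' : (s : ℝ) + 2 ≤ 2 ^ (m + 2) * (A + 1) := by
    have := Nat.floor_le (show 0 ≤ 2 * ((2 ^ m - 1) * A) by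
      have : (0 : ℝ) ≤ 2 ^ m - 1 := by linarith
      positivity)
    push_cast [s]
    have e : (2 : ℝ) ^ (m + 2) = 4 * 2 ^ m := by ring
    rw [e]
    nlinarith
  have hD : ((m * (s + 2) ^ (m - 1) : ℕ) : ℝ) ≤ m * (2 ^ (m + 2)) ^ (m - 1) * (A + 1) ^ (m - 1) := by
    push_cast
    rw [mul_assoc, ← mul_pow]
    gcongr
  set D : ℕ := m * (s + 2) ^ (m - 1)
  have hDq : 2 ^ (m + 1) * (D : ℝ) ≤ q * ε := by
    rw [div_le_iff₀ hε] at hq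
    refine le_trans ?_ hq
    rw [mul_assoc (2 ^ (m + 1) : ℝ)]
    gcongr
  have hq2 : (2 : ℝ) * D ≤ q := by
    have h1 : (2 : ℝ) * D ≤ 2 ^ (m + 1) * D := by
      gcongr
      rw [pow_succ]
      linarith
    have h2 : q * ε ≤ q := mul_le_of_le_one_right (by linarith) hε1
    linarith
  have h := partitionRank_mul_le hm T s hs hq2
  -- This makes `2 ^ m δ ≤ ε / 2`, so the factor `1 - δ` is absorbed: `(2 ^ m - 1 + ε) (1 - δ) ≥ 2 ^
  -- m - 1`.
  have hδ : 2 ^ (m + 1) * ((D : ℝ) / q) ≤ ε := by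
    rw [mul_div_assoc', div_le_iff₀ (by linarith)]
    linarith
  have hδ0 : 0 ≤ (D : ℝ) / q := by positivity
  change partitionRank T * (1 - (D : ℝ) / q) ≤ (2 ^ m - 1) * A at h
  set δ := (D : ℝ) / q
  have e : (2 : ℝ) ^ (m + 1) = 2 * 2 ^ m := by ring
  rw [e] at hδ
  have hδ1 : 0 < 1 - δ := by nlinarith
  have h3 : (2 ^ m - 1) ≤ (2 ^ m - 1 + ε) * (1 - δ) := by nlinarith
  refine le_of_mul_le_mul_right (h.trans ?_) hδ1
  nlinarith [mul_le_mul_of_nonneg_right h3 hA]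

end Main

end TensorRank

theorem mainTheorem2 (k : ℕ) (hk : 2 ≤ k) :
    ∃ C : ℝ, 0 < C ∧
      ∀ (F : Type*) [Field F] [Finite F] (n : ℕ) (T : TensorRank.Tensor F k n) (ε : ℝ),
        0 < ε → ε ≤ 1 →
        C * (TensorRank.analyticRank T + 1) ^ (k - 2) / ε ≤ (Nat.card F : ℝ) →
        (TensorRank.partitionRank T : ℝ) ≤
          (2 ^ (k - 1) - 1 + ε) * TensorRank.analyticRank T := by
  classical
  obtain ⟨m, rfl⟩ : ∃ m, k = m + 1 := ⟨k - 1, by omega⟩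
  have hm : 0 < m := by omega
  -- The factor `2 ^ (m + 1)` absorbs the loss `1 - δ`; the rest comes from `D = m (s + 2) ^ (m -
  -- 1)` and `s + 2 ≤ 2 ^ (m + 2) (AR(T) + 1)`.
  refine ⟨2 ^ (m + 1) * (m * (2 ^ (m + 2)) ^ (m - 1)), by positivity, ?_⟩
  intro F _ _ n T ε hε hε1 hq
  have : Fintype F := Fintype.ofFinite F
  rw [Nat.card_eq_fintype_card] at hq
  exact TensorRank.partitionRank_le_of_card_le hm T hε hε1 hq
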